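/- Let $\mathbb S=\{z\in\mathbb C: 0<\operatorname{Re} z<1\}$ and let $\mathscr Z=\mathscr C(\ell_\infty,\ell_1)$ be the Calderón space of the couple of complex sequence spaces $(\ell_\infty,\ell_1)$: the space of all bounded continuous functions $f:\overline{\mathbb S}\to\ell_\infty$ that are analytic on $\mathbb S$ and for which $t\mapsto f(1+it)$ is a bounded continuous function from $\mathbb R$ to $\ell_1$, with the norm $$\|f\|_{\mathscr Z}=\sup\{\|f(it)\|_\infty,\ \|f(1+it)\|_1 : t\in\mathbb R\}.$$ For $m\ge 0$ let $\mathscr Z_m$ be the $m$-th Rochberg space of $\mathscr Z$ at $z=\tfrac12$, that is, $$\mathscr Z_m=\Big\{(w_{m-1},\dots,w_0)\in(\ell_\infty)^m : \text{there is } f\in\mathscr Z \text{ with } w_i=\tfrac{f^{(i)}(1/2)}{i!}\text{ for } 0\le i<m\Big\},$$ normed by $\|w\|_{\mathscr Z_m}=\inf\{\|f\|_{\mathscr Z}: f\in\mathscr Z,\ w_i=f^{(i)}(1/2)/i!\text{ for } 0\le i<m\}$; in particular $\mathscr Z_0=0$. Let $n,k,j$ be integers with $0\le k,j\le n$. Then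 the Banach spaces $\mathscr Z_{n-k}\oplus\mathscr Z_{n+k}$ and $\mathscr Z_{n-j}\oplus\mathscr Z_{n+j}$ are linearly homeomorphic if and only if $k=j$. -/

import Mathlib

open scoped BoundedContinuousFunction ENNReal
open Complex.HadamardThreeLines (verticalStrip verticalClosedStrip)

noncomputable section

namespace Rochberg

/-- A function on the closed unit strip, regarded as a function on `ℂ` (zero off the strip). -/
def stripExt {E : Type*} [Zero E] (f : verticalClosedStrip 0 1 → E) : ℂ → E :=
  Function.extend Subtype.val f 0

theorem stripExt_apply {E : Type*} [Zero E] (f : verticalClosedStrip 0 1 → E)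
    {z : ℂ} (hz : z ∈ verticalClosedStrip 0 1) : stripExt f z = f ⟨z, hz⟩ :=
  Subtype.val_injective.extend_apply f 0 (⟨z, hz⟩ : verticalClosedStrip 0 1)

theorem stripExt_zero {E : Type*} [Zero E] : stripExt (0 : verticalClosedStrip 0 1 → E) = 0 := by
  funext z
  by_cases hz : z ∈ verticalClosedStrip 0 1
  · simp [stripExt_apply _ hz]
  · exact Function.extend_apply' _ _ _ (by rintro ⟨a, rfl⟩; exact hz a.2)

theorem stripExt_add {E : Type*} [AddZeroClass E] (f g : verticalClosedStrip 0 1 → E) :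
    stripExt (f + g) = stripExt f + stripExt g := by
  have h := Function.extend_add (Subtype.val : verticalClosedStrip 0 1 → ℂ) f g 0 0
  rw [add_zero] at h
  exact h

theorem stripExt_smul {E : Type*} [AddCommMonoid E] [Module ℂ E] (c : ℂ)
    (f : verticalClosedStrip 0 1 → E) : stripExt (c • f) = c • stripExt f := by
  have h := Function.extend_smul c (Subtype.val : verticalClosedStrip 0 1 → ℂ) f 0
  rw [smul_zero] at h
  exact h

/-- The point `it` of the left boundary line of the strip. -/
def leftPt (t : ℝ) : verticalClosedStrip 0 1 :=
  ⟨t * Complex.I, by simp [verticalClosedStrip]⟩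

/-- The point `1 + it` of the right boundary line of the strip. -/
def rightPt (t : ℝ) : verticalClosedStrip 0 1 :=
  ⟨1 + t * Complex.I, by simp [verticalClosedStrip]⟩

section Couple

variable {X₀ X₁ E : Type*}
  [NormedAddCommGroup X₀] [NormedSpace ℂ X₀] [NormedAddCommGroup X₁] [NormedSpace ℂ X₁]
  [NormedAddCommGroup E] [NormedSpace ℂ E]

/-- For a couple `ι₀ : X₀ → E`, `ι₁ : X₁ → E` of continuous linear embeddings: the bounded
continuous functions `f` from the closed unit strip to `E` that are analytic on the open strip,
together with the (uniquely determined) functions `g₀`, `g₁` that express the boundary values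
`f (it)`, `f (1 + it)` as bounded continuous functions of `t` with values in `X₀`, `X₁`. -/
def calderonSubmodule (ι₀ : X₀ →L[ℂ] E) (ι₁ : X₁ →L[ℂ] E) :
    Submodule ℂ ((verticalClosedStrip 0 1 →ᵇ E) × (ℝ →ᵇ X₀) × (ℝ →ᵇ X₁)) where
  carrier := {p | DifferentiableOn ℂ (stripExt p.1) (verticalStrip 0 1) ∧
    (∀ t, p.1 (leftPt t) = ι₀ (p.2.1 t)) ∧ (∀ t, p.1 (rightPt t) = ι₁ (p.2.2 t))}
  zero_mem' := by
    refine ⟨?_, fun t => by simp, fun t => by simp⟩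
    change DifferentiableOn ℂ (stripExt (0 : verticalClosedStrip 0 1 → E)) _
    rw [stripExt_zero]
    exact differentiableOn_const 0
  add_mem' := by
    rintro p q ⟨hp, hp₀, hp₁⟩ ⟨hq, hq₀, hq₁⟩
    refine ⟨?_, fun t => by simp [hp₀, hq₀], fun t => by simp [hp₁, hq₁]⟩
    change DifferentiableOn ℂ (stripExt ((p.1 : verticalClosedStrip 0 1 → E) + (q.1 : verticalClosedStrip 0 1 → E))) _
    rw [stripExt_add]
    exact hp.add hq
  smul_mem' := by
    rintro c p ⟨hp, hp₀, hp₁⟩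
    refine ⟨?_, fun t => by simp [hp₀], fun t => by simp [hp₁]⟩
    change DifferentiableOn ℂ (stripExt (c • (p.1 : verticalClosedStrip 0 1 → E))) _
    rw [stripExt_smul]
    exact hp.const_smul c

/-- The Calderón space of the couple on the unit strip. It carries the norm
`sup {‖f (j + it)‖_{X_j} : t ∈ ℝ, j = 0, 1}`, defined below, not the norm of the ambient product. -/
def Calderon (ι₀ : X₀ →L[ℂ] E) (ι₁ : X₁ →L[ℂ] E) : Type _ := calderonSubmodule ι₀ ι₁

namespace Calderon

variable {ι₀ : X₀ →L[ℂ] E} {ι₁ : X₁ →L[ℂ] E}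

instance : AddCommGroup (Calderon ι₀ ι₁) := inferInstanceAs (AddCommGroup (calderonSubmodule ι₀ ι₁))

instance : Module ℂ (Calderon ι₀ ι₁) := inferInstanceAs (Module ℂ (calderonSubmodule ι₀ ι₁))

/-- The function on the closed strip (extended by zero to `ℂ`). -/
def toFun (f : Calderon ι₀ ι₁) : ℂ → E := stripExt f.1.1

theorem toFun_add (f g : Calderon ι₀ ι₁) : (f + g).toFun = f.toFun + g.toFun :=
  stripExt_add (f.1.1 : verticalClosedStrip 0 1 → E) g.1.1

theorem toFun_smul (c : ℂ) (f : Calderon ι₀ ι₁) : (c • f).toFun = c • f.toFun :=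
  stripExt_smul c (f.1.1 : verticalClosedStrip 0 1 → E)

theorem differentiableOn (f : Calderon ι₀ ι₁) :
    DifferentiableOn ℂ f.toFun (verticalStrip 0 1) := f.2.1

/-- The boundary functions `t ↦ f (it) ∈ X₀` and `t ↦ f (1 + it) ∈ X₁`. -/
def boundary : Calderon ι₀ ι₁ →ₗ[ℂ] (ℝ →ᵇ X₀) × (ℝ →ᵇ X₁) :=
  (LinearMap.snd ℂ _ _).comp (calderonSubmodule ι₀ ι₁).subtype

theorem isOpen_strip : IsOpen (verticalStrip 0 1) := isOpen_Ioo.preimage Complex.continuous_re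

theorem strip_subset : verticalStrip 0 1 ⊆ verticalClosedStrip 0 1 :=
  Set.preimage_mono Set.Ioo_subset_Icc_self

theorem closure_strip : closure (verticalStrip 0 1) = verticalClosedStrip 0 1 := by
  rw [verticalStrip, Complex.closure_preimage_re, closure_Ioo zero_ne_one, verticalClosedStrip]

/-- Maximum principle: the functions of the space are controlled by their boundary values. -/
theorem norm_toFun_le (f : Calderon ι₀ ι₁) {z : ℂ} (hz : z ∈ verticalClosedStrip 0 1) :
    ‖f.toFun z‖ ≤ max ‖ι₀‖ ‖ι₁‖ * ‖boundary f‖ := by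
  have hcont : ContinuousOn f.toFun (verticalClosedStrip 0 1) := by
    rw [continuousOn_iff_continuous_domRestrict]
    have : (verticalClosedStrip 0 1).domRestrict f.toFun = f.1.1 := by
      funext w
      exact stripExt_apply _ w.2
    rw [this]
    exact f.1.1.continuous
  refine PhragmenLindelof.vertical_strip (a := 0) (b := 1) (f := f.toFun)
    ⟨f.differentiableOn, by rw [← verticalStrip, closure_strip]; exact hcont⟩ ?_ ?_ ?_ hz.1 hz.2
  · refine ⟨0, by positivity, 0, ?_⟩
    refine Asymptotics.IsBigO.of_bound ‖f.1.1‖ ?_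
    refine Filter.Eventually.filter_mono inf_le_right ?_
    refine Filter.eventually_principal.2 fun w hw => ?_
    have : f.toFun w = f.1.1 ⟨w, strip_subset hw⟩ := stripExt_apply _ _
    rw [this]
    simpa using f.1.1.norm_coe_le_norm _
  · intro w hw
    have h1 : w = leftPt w.im := by apply Complex.ext <;> simp [leftPt, hw]
    have h2 : f.toFun w = ι₀ ((boundary f).1 w.im) := by
      refine Eq.trans ?_ (f.2.2.1 w.im)
      rw [toFun, stripExt_apply _ (h1 ▸ (leftPt w.im).2)]
      exact congrArg f.1.1 (Subtype.ext h1)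
    rw [h2]
    exact (ι₀.le_opNorm _).trans (mul_le_mul (le_max_left _ _)
      (((boundary f).1.norm_coe_le_norm _).trans (norm_fst_le _)) (norm_nonneg _)
      (le_max_of_le_left (norm_nonneg _)))
  · intro w hw
    have h1 : w = rightPt w.im := by apply Complex.ext <;> simp [rightPt, hw]
    have h2 : f.toFun w = ι₁ ((boundary f).2 w.im) := by
      refine Eq.trans ?_ (f.2.2.2 w.im)
      rw [toFun, stripExt_apply _ (h1 ▸ (rightPt w.im).2)]
      exact congrArg f.1.1 (Subtype.ext h1)
    rw [h2]
    exact (ι₁.le_opNorm _).trans (mul_le_mul (le_max_right _ _)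
      (((boundary f).2.norm_coe_le_norm _).trans (norm_snd_le _)) (norm_nonneg _)
      (le_max_of_le_left (norm_nonneg _)))

theorem boundary_injective : Function.Injective (boundary (ι₀ := ι₀) (ι₁ := ι₁)) := by
  rw [injective_iff_map_eq_zero]
  intro f hf
  refine Subtype.ext (Prod.ext ?_ hf)
  ext z
  have h := f.norm_toFun_le z.2
  rw [hf, norm_zero, mul_zero, norm_le_zero_iff, toFun, stripExt_apply _ z.2] at h
  exact h

/-- The norm is `‖f‖ = max (sup_t ‖f (it)‖_{X₀}) (sup_t ‖f (1 + it)‖_{X₁})`. -/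
instance : NormedAddCommGroup (Calderon ι₀ ι₁) :=
  NormedAddCommGroup.induced (Calderon ι₀ ι₁) ((ℝ →ᵇ X₀) × (ℝ →ᵇ X₁)) boundary boundary_injective

instance : NormedSpace ℂ (Calderon ι₀ ι₁) :=
  NormedSpace.induced ℂ (Calderon ι₀ ι₁) ((ℝ →ᵇ X₀) × (ℝ →ᵇ X₁)) boundary

theorem norm_def (f : Calderon ι₀ ι₁) :
    ‖f‖ = max (⨆ t : ℝ, ‖(boundary f).1 t‖) (⨆ t : ℝ, ‖(boundary f).2 t‖) := by
  rw [← BoundedContinuousFunction.norm_eq_iSup_norm, ← BoundedContinuousFunction.norm_eq_iSup_norm]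
  rfl

variable [CompleteSpace E]

theorem contDiffAt (f : Calderon ι₀ ι₁) {z : ℂ} (hz : z ∈ verticalStrip 0 1) (i : ℕ) :
    ContDiffAt ℂ i f.toFun z :=
  (f.differentiableOn.contDiffOn isOpen_strip).contDiffAt (isOpen_strip.mem_nhds hz)

/-- The `i`-th Taylor coefficient `f ↦ f⁽ⁱ⁾(z) / i!` at a point `z` of the open strip. -/
def taylorCoeff (z : verticalStrip 0 1) (i : ℕ) : Calderon ι₀ ι₁ →ₗ[ℂ] E where
  toFun f := ((Nat.factorial i : ℂ))⁻¹ • iteratedDeriv i f.toFun z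
  map_add' f g := by
    rw [toFun_add, iteratedDeriv_add (f.contDiffAt z.2 i) (g.contDiffAt z.2 i), smul_add]
  map_smul' c f := by
    rw [toFun_smul, iteratedDeriv_const_smul (f.contDiffAt z.2 i), smul_comm]
    rfl

theorem continuous_taylorCoeff (z : verticalStrip 0 1) (i : ℕ) :
    Continuous (taylorCoeff (ι₀ := ι₀) (ι₁ := ι₁) z i) := by
  obtain ⟨R, hR, hsub⟩ := Metric.nhds_basis_closedBall.mem_iff.1 (isOpen_strip.mem_nhds z.2)
  refine AddMonoidHomClass.continuous_of_bound (taylorCoeff (ι₀ := ι₀) (ι₁ := ι₁) z i)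
    (‖((Nat.factorial i : ℂ))⁻¹‖ * (Nat.factorial i * max ‖ι₀‖ ‖ι₁‖ / R ^ i)) fun f => ?_
  have h := Complex.norm_iteratedDeriv_le_of_forall_mem_sphere_norm_le (c := (z : ℂ)) (R := R)
    (C := max ‖ι₀‖ ‖ι₁‖ * ‖boundary f‖) (f := f.toFun) i hR
    ((f.differentiableOn.mono hsub).diffContOnCl_ball subset_rfl)
    (fun w hw => f.norm_toFun_le (strip_subset (hsub (Metric.sphere_subset_closedBall hw))))
  have hb : ‖boundary f‖ = ‖f‖ := rfl
  rw [hb] at h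
  change ‖((Nat.factorial i : ℂ))⁻¹ • iteratedDeriv i f.toFun z‖ ≤ _
  rw [norm_smul, mul_assoc]
  refine mul_le_mul_of_nonneg_left (h.trans_eq (by ring)) (norm_nonneg _)

/-- The list of the first `n` Taylor coefficients at `z`; coordinate `i` is `f⁽ⁱ⁾(z) / i!`. -/
def taylor (z : verticalStrip 0 1) (n : ℕ) : Calderon ι₀ ι₁ →L[ℂ] (Fin n → E) where
  toLinearMap := LinearMap.pi fun i => taylorCoeff z i
  cont := continuous_pi fun i => continuous_taylorCoeff z i

instance (z : verticalStrip 0 1) (n : ℕ) :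
    IsClosed ((LinearMap.ker (taylor (ι₀ := ι₀) (ι₁ := ι₁) z n).toLinearMap :
      Submodule ℂ (Calderon ι₀ ι₁)) : Set (Calderon ι₀ ι₁)) :=
  (taylor z n).isClosed_ker

end Calderon

variable [CompleteSpace E]

open Calderon

/-- The `n`-th Rochberg space of the Calderón space at `z`: all lists `w ∈ Eⁿ` of the first `n`
Taylor coefficients at `z` of functions of the Calderón space, with the quotient norm. -/
def RochbergSpace (ι₀ : X₀ →L[ℂ] E) (ι₁ : X₁ →L[ℂ] E) (z : verticalStrip 0 1) (n : ℕ) : Type _ :=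
  LinearMap.range (taylor (ι₀ := ι₀) (ι₁ := ι₁) z n).toLinearMap

namespace RochbergSpace

variable {ι₀ : X₀ →L[ℂ] E} {ι₁ : X₁ →L[ℂ] E} {z : verticalStrip 0 1} {n : ℕ}

instance : AddCommGroup (RochbergSpace ι₀ ι₁ z n) :=
  inferInstanceAs (AddCommGroup (LinearMap.range (taylor (ι₀ := ι₀) (ι₁ := ι₁) z n).toLinearMap))

instance : Module ℂ (RochbergSpace ι₀ ι₁ z n) :=
  inferInstanceAs (Module ℂ (LinearMap.range (taylor (ι₀ := ι₀) (ι₁ := ι₁) z n).toLinearMap))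

/-- The algebraic identification with the quotient of the Calderón space by the functions whose
first `n` Taylor coefficients at `z` vanish. -/
def toQuotient : RochbergSpace ι₀ ι₁ z n ≃ₗ[ℂ]
    (Calderon ι₀ ι₁ ⧸ LinearMap.ker (taylor (ι₀ := ι₀) (ι₁ := ι₁) z n).toLinearMap) :=
  (taylor (ι₀ := ι₀) (ι₁ := ι₁) z n).toLinearMap.quotKerEquivRange.symm

instance : NormedAddCommGroup (RochbergSpace ι₀ ι₁ z n) :=
  NormedAddCommGroup.induced (RochbergSpace ι₀ ι₁ z n)
    (Calderon ι₀ ι₁ ⧸ LinearMap.ker (taylor (ι₀ := ι₀) (ι₁ := ι₁) z n).toLinearMap)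
    toQuotient toQuotient.injective

instance : NormedSpace ℂ (RochbergSpace ι₀ ι₁ z n) :=
  NormedSpace.induced ℂ (RochbergSpace ι₀ ι₁ z n)
    (Calderon ι₀ ι₁ ⧸ LinearMap.ker (taylor (ι₀ := ι₀) (ι₁ := ι₁) z n).toLinearMap) toQuotient

/-- The norm of `w` is the infimum of the norms of the functions with Taylor coefficients `w`. -/
theorem norm_def (w : RochbergSpace ι₀ ι₁ z n) :
    ‖w‖ = sInf (norm '' {f : Calderon ι₀ ι₁ | taylor z n f = w.1}) := by
  have key : ∀ f : Calderon ι₀ ι₁, taylor z n f = w.1 ↔ Submodule.Quotient.mk f = toQuotient w := by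
    intro f
    have h := LinearEquiv.eq_symm_apply (x := w) (y := Submodule.Quotient.mk f)
      (taylor (ι₀ := ι₀) (ι₁ := ι₁) z n).toLinearMap.quotKerEquivRange
    exact (h.trans Subtype.ext_iff).symm
  have hne : {f : Calderon ι₀ ι₁ | taylor z n f = w.1}.Nonempty := w.2
  change ‖toQuotient w‖ = _
  refine le_antisymm (le_csInf (hne.image _) ?_) (QuotientAddGroup.le_norm_iff.2 fun f hf => ?_)
  · rintro _ ⟨f, hf, rfl⟩
    rw [← (key f).1 hf]
    exact Submodule.Quotient.norm_mk_le _ f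
  · exact csInf_le ⟨0, by rintro _ ⟨g, -, rfl⟩; exact norm_nonneg g⟩ ⟨f, (key f).2 hf, rfl⟩

end RochbergSpace

end Couple

/-- `ℓ_p` over `ℂ`. -/
abbrev ell (p : ℝ≥0∞) : Type := lp (fun _ : ℕ => ℂ) p

/-- The inclusion of `ℓ₁` in `ℓ_∞`. -/
def ellOneIncl : ell 1 →L[ℂ] ell ∞ :=
  (lp.linearMapOfLE ℂ (fun _ : ℕ => ℂ) (le_top : (1 : ℝ≥0∞) ≤ ∞)).mkContinuous 1 fun x => by
    rw [one_mul]
    refine lp.norm_le_of_forall_le (norm_nonneg _) fun i => ?_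
    rw [lp.coe_linearMapOfLE_apply]
    exact lp.norm_apply_le_norm one_ne_zero x i

/-- The base point `1/2` of the strip. -/
def half : verticalStrip 0 1 := ⟨1 / 2, by simp [verticalStrip]; norm_num⟩

/-- The `n`-th Rochberg space of the couple `(ℓ_∞, ℓ₁)` at `1/2` (`Z 0` is the zero space). -/
abbrev Z (n : ℕ) : Type :=
  RochbergSpace (ContinuousLinearMap.id ℂ (ell ∞)) ellOneIncl half n

end Rochberg

end

/-! The invariant that separates the direct sums is the growth of Rademacher type 2 constants on `N`
vectors. For a Rochberg space of order `b ≥ 1` the constant on `N = 2 ^ k` vectors is of order `(log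
N) ^ (b - 1)`. A direct sum inherits the growth of the summand of larger order, and an isomorphism
changes type 2 constants only by a bounded factor. Hence the larger orders `n + k` and `n + j`
agree.

Upper bound (`HasTypeTwo.sum`, `exists_hasTypeTwo`). `Z (m + 1)` is a twisted sum: evaluation at
`1/2` maps it onto the Hilbert space `ℓ₂`, and the kernel is a copy of `Z m`, embedded through
multiplication by a bounded analytic function with a simple zero at `1/2`. When the number of
vectors doubles, the parallelogram law in `ℓ₂` keeps the constant of `Z (m + 1)` from being
multiplied. It only grows by a multiple of the constant of `Z m`. Summing over `k` doublings raises
the power of `k` by one at each order, from the second on.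

Lower bound (`norm_mk_sum_unitVec_ge`). The unit vectors, as constant functions, have norm at most
one in `Z (m + 1)`. Pairing a signed sum of `N` of them with the weight `exp ((z - 1) log N)` gives
`exp (z log N)`, whose `m`-th derivative at `1/2` is `√N (log N) ^ m`. Every competitor for the
quotient norm has the same derivative there, and the maximum principle with Cauchy's estimate bounds
that derivative by a multiple of its norm.

`log_pow_le_of_leftInverse` sets the two bounds against each other through an operator and a left
inverse. -/

noncomputable section

namespace Rochberg

/-! ### Type 2 constants of twisted sums with a Hilbert space. -/

section Rademacher

/-- Minkowski's inequality for finite sums, in squared form. -/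
theorem sum_add_sq_le {α : Type*} (s : Finset α) (a b : α → ℝ) {A B : ℝ} (hA : 0 ≤ A) (hB : 0 ≤ B)
    (ha : ∑ i ∈ s, a i ^ 2 ≤ A ^ 2) (hb : ∑ i ∈ s, b i ^ 2 ≤ B ^ 2) :
    ∑ i ∈ s, (a i + b i) ^ 2 ≤ (A + B) ^ 2 := by
  have h1 : (∑ i ∈ s, a i * b i) ≤ A * B := by
    refine abs_le_of_sq_le_sq' ?_ (mul_nonneg hA hB) |>.2
    refine (Finset.sum_mul_sq_le_sq_mul_sq s a b).trans ?_
    rw [mul_pow]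
    exact mul_le_mul ha hb (Finset.sum_nonneg fun i _ => sq_nonneg _) (sq_nonneg _)
  have h2 : ∑ i ∈ s, (a i + b i) ^ 2
      = ∑ i ∈ s, a i ^ 2 + 2 * ∑ i ∈ s, a i * b i + ∑ i ∈ s, b i ^ 2 := by
    rw [Finset.mul_sum, ← Finset.sum_add_distrib, ← Finset.sum_add_distrib]
    exact Finset.sum_congr rfl fun i _ => by ring
  rw [h2]
  nlinarith

variable {E H : Type*} [AddCommGroup E] [Module ℂ E] [NormedAddCommGroup H] [InnerProductSpace ℂ H]

/-- The seminorm `p` has type-2 constant at most `A` on families indexed by `ι`. -/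
def HasTypeTwo (p : Seminorm ℂ E) (ι : Type*) [Fintype ι] [DecidableEq ι] (A : ℝ) : Prop :=
  ∀ x : ι → E, ∑ ε : ι → ℤˣ, p (∑ i, ε i • x i) ^ 2
    ≤ A ^ 2 * (2 ^ Fintype.card ι * ∑ i, p (x i) ^ 2)

theorem card_signs (ι : Type*) [Fintype ι] [DecidableEq ι] :
    (Fintype.card (ι → ℤˣ) : ℝ) = 2 ^ Fintype.card ι := by
  simp [Fintype.card_pi]

theorem seminorm_units_smul (p : Seminorm ℂ E) (u : ℤˣ) (x : E) : p (u • x) = p x := by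
  rcases Int.units_eq_one_or u with rfl | rfl <;> simp

theorem map_units_smul {G G' F : Type*} [AddCommGroup G] [AddCommGroup G'] [FunLike F G G']
    [AddMonoidHomClass F G G'] (f : F) (u : ℤˣ) (x : G) : f (u • x) = u • f x := by
  rw [Units.smul_def, Units.smul_def, map_zsmul]

theorem HasTypeTwo.of_equiv {p : Seminorm ℂ E} {ι κ : Type*} [Fintype ι] [DecidableEq ι]
    [Fintype κ] [DecidableEq κ] (e : ι ≃ κ) {A : ℝ} (h : HasTypeTwo p ι A) :
    HasTypeTwo p κ A := by
  intro x
  have := h (x ∘ e)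
  rw [Fintype.card_congr e] at this
  refine (le_of_eq ?_).trans (this.trans_eq ?_)
  · refine Fintype.sum_equiv (Equiv.arrowCongr e.symm (Equiv.refl _)) _ _ fun ε => ?_
    congr 2
    refine (Fintype.sum_equiv e _ _ fun i => ?_).symm
    simp
  · congr 2
    exact Fintype.sum_equiv e _ _ fun i => by simp

theorem HasTypeTwo.mono {p : Seminorm ℂ E} {ι : Type*} [Fintype ι] [DecidableEq ι] {A B : ℝ}
    (h : HasTypeTwo p ι A) (hA : 0 ≤ A) (hAB : A ≤ B) : HasTypeTwo p ι B := fun x =>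
  (h x).trans (mul_le_mul_of_nonneg_right (pow_le_pow_left₀ hA hAB 2)
    (mul_nonneg (by positivity) (Finset.sum_nonneg fun _ _ => sq_nonneg _)))

/-- Sums over the signs on `ι ⊕ ι`, rearranged. -/
theorem sum_signs_sum {ι : Type*} [Fintype ι] [DecidableEq ι] (p : Seminorm ℂ E) (x : ι ⊕ ι → E) :
    ∑ η : ι ⊕ ι → ℤˣ, p (∑ i, η i • x i) ^ 2 = ∑ δ : ι → ℤˣ, ∑ ε : ι → ℤˣ,
      p (∑ i, ε i • (x (Sum.inl i) + δ i • x (Sum.inr i))) ^ 2 := by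
  rw [Finset.sum_comm]
  rw [Fintype.sum_equiv (Equiv.sumArrowEquivProdArrow ι ι ℤˣ) _
    (fun q => p (∑ i, q.1 i • x (Sum.inl i) + ∑ i, q.2 i • x (Sum.inr i)) ^ 2)
    (fun η => by simp [Equiv.sumArrowEquivProdArrow]), Fintype.sum_prod_type]
  refine Finset.sum_congr rfl fun ε _ => ?_
  -- For fixed `ε`, multiplication by `ε` permutes the sign vectors, so the signs of the second
  -- block may be written as `ε i * δ i`.
  refine (Fintype.sum_equiv (Equiv.mulLeft ε) _ _ fun δ => ?_).symm
  simp [smul_add, smul_smul, Finset.sum_add_distrib]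

/-- Parallelogram law, after pairing `δ` with `-δ`. The Hilbert structure enters here: merging two
vectors into one with a random sign costs nothing on average, so type 2 constants grow additively
and not by a factor. -/
theorem sum_signs_norm_add_sq {ι : Type*} [Fintype ι] [DecidableEq ι] (i : ι) (a b : H) :
    ∑ δ : ι → ℤˣ, ‖a + δ i • b‖ ^ 2 = 2 ^ Fintype.card ι * (‖a‖ ^ 2 + ‖b‖ ^ 2) := by
  have h1 : ∑ δ : ι → ℤˣ, ‖a + δ i • b‖ ^ 2 = ∑ δ : ι → ℤˣ, ‖a - δ i • b‖ ^ 2 :=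
    Fintype.sum_equiv (Equiv.neg _) _ _ fun δ => by simp [Units.neg_smul]
  have h2 : ∀ δ : ι → ℤˣ, ‖a + δ i • b‖ ^ 2 + ‖a - δ i • b‖ ^ 2 = 2 * (‖a‖ ^ 2 + ‖b‖ ^ 2) := by
    intro δ
    have hb : ‖δ i • b‖ = ‖b‖ := seminorm_units_smul (normSeminorm ℂ H) (δ i) b
    have := parallelogram_law_with_norm ℂ a (δ i • b)
    rw [hb] at this
    linarith
  have h3 := Finset.sum_congr rfl fun δ (_ : δ ∈ (Finset.univ : Finset (ι → ℤˣ))) => h2 δ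
  rw [Finset.sum_add_distrib, ← h1, Finset.sum_const, Finset.card_univ, nsmul_eq_mul,
    card_signs] at h3
  linarith

/-- Lifts from the quotient are only almost norm-preserving; a limit removes the error `η`. -/
theorem HasTypeTwo.of_forall_pos {p : Seminorm ℂ E} {ι : Type*} [Fintype ι] [DecidableEq ι]
    {A B : ℝ} (h : ∀ η : ℝ, 0 < η → η ≤ 1 → HasTypeTwo p ι ((1 + η) * A + B)) :
    HasTypeTwo p ι (A + B) := by
  intro x
  have hc : Filter.Tendsto (fun η : ℝ =>
      ((1 + η) * A + B) ^ 2 * (2 ^ Fintype.card ι * ∑ i, p (x i) ^ 2)) (nhdsWithin 0 (Set.Ioi 0))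
      (nhds (((1 + 0) * A + B) ^ 2 * (2 ^ Fintype.card ι * ∑ i, p (x i) ^ 2))) :=
    Filter.Tendsto.mono_left (Continuous.tendsto (by fun_prop) 0) nhdsWithin_le_nhds
  rw [add_zero, one_mul] at hc
  refine ge_of_tendsto hc ?_
  filter_upwards [Ioc_mem_nhdsGT (zero_lt_one' ℝ)] with η hη
  exact h η hη.1 hη.2 x

/-- Type 2 constants of a twisted sum of a Hilbert space with another space: passing from families
indexed by `ι` to families of twice the size adds a multiple of the type 2 constant of the kernel. -/
theorem HasTypeTwo.sum {p p' : Seminorm ℂ E} (q : E →ₗ[ℂ] H) (L : E →ₗ[ℂ] E) {C : ℝ} (hC : 0 ≤ C)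
    (hq : ∀ f, ‖q f‖ ≤ p f)
    (hlift : ∀ y, ∀ η : ℝ, 0 < η → ∃ h, q h = q y ∧ p h ≤ (1 + η) * ‖q y‖)
    (hker : ∀ f, q f = 0 → ∃ g, p (f - L g) = 0 ∧ p' g ≤ C * p f)
    (hL : ∀ g, p (L g) ≤ C * p' g)
    {ι : Type*} [Fintype ι] [DecidableEq ι] {A A' : ℝ} (hA : 0 ≤ A) (hA' : 0 ≤ A')
    (h : HasTypeTwo p ι A) (h' : HasTypeTwo p' ι A') :
    HasTypeTwo p (ι ⊕ ι) (A + 5 * C ^ 2 * A') := by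
  refine HasTypeTwo.of_forall_pos fun η hη0 hη1 x => ?_
  set S : ℝ := ∑ i, p (x i) ^ 2 with hS
  have hS0 : 0 ≤ S := Finset.sum_nonneg fun i _ => sq_nonneg _
  have hSs : S = ∑ i, (p (x (Sum.inl i)) ^ 2 + p (x (Sum.inr i)) ^ 2) := by
    rw [hS, Fintype.sum_sum_type, Finset.sum_add_distrib]
  set M : ℝ := 2 ^ Fintype.card ι with hM
  have hM0 : 0 ≤ M := by positivity
  let y : (ι → ℤˣ) → ι → E := fun δ i => x (Sum.inl i) + δ i • x (Sum.inr i)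
  have hy : ∀ δ i, p (y δ i) ≤ p (x (Sum.inl i)) + p (x (Sum.inr i)) := fun δ i =>
    (map_add_le_add p _ _).trans_eq (by rw [seminorm_units_smul])
  -- Each merged vector `y δ i` is split into an almost optimal lift `k δ i` of its image in the
  -- Hilbert space and a remainder in the kernel of `q`, represented by `g δ i` up to a vector of
  -- seminorm zero.
  choose k hkq hkp using fun δ i => hlift (y δ i) η hη0
  choose g hgL hgp using fun δ i => hker (y δ i - k δ i) (by rw [map_sub, hkq, sub_self])
  -- The 18 is `3 ^ 2 * 2`: the remainder has seminorm at most `(1 + 2) * p (y δ i)` because `η ≤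
  -- 1`, and `(s + t) ^ 2 ≤ 2 * (s ^ 2 + t ^ 2)`.
  have hg : ∀ δ i, p' (g δ i) ^ 2
      ≤ 18 * C ^ 2 * (p (x (Sum.inl i)) ^ 2 + p (x (Sum.inr i)) ^ 2) := by
    intro δ i
    have h1 : p (y δ i - k δ i) ≤ 3 * (p (x (Sum.inl i)) + p (x (Sum.inr i))) := by
      have h2 := map_sub_le_add p (y δ i) (k δ i)
      have h3 : p (k δ i) ≤ 2 * p (y δ i) := (hkp δ i).trans
        (mul_le_mul (by linarith) (hq _) (norm_nonneg _) (by norm_num))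
      linarith [hy δ i]
    have h4 : p' (g δ i) ^ 2 ≤ (C * (3 * (p (x (Sum.inl i)) + p (x (Sum.inr i))))) ^ 2 :=
      pow_le_pow_left₀ (apply_nonneg _ _)
        ((hgp δ i).trans (mul_le_mul_of_nonneg_left h1 hC)) 2
    refine h4.trans ?_
    have : 0 ≤ C ^ 2 * (p (x (Sum.inl i)) - p (x (Sum.inr i))) ^ 2 := by positivity
    nlinarith
  rw [sum_signs_sum]
  have hcard : (2 : ℝ) ^ Fintype.card (ι ⊕ ι) = M * M := by
    rw [Fintype.card_sum, pow_add]
  rw [hcard]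
  have hpt : ∀ δ ε : ι → ℤˣ, p (∑ i, ε i • y δ i)
      ≤ p (∑ i, ε i • k δ i) + C * p' (∑ i, ε i • g δ i) := by
    intro δ ε
    have e1 : ∑ i, ε i • y δ i = ∑ i, ε i • k δ i + (∑ i, ε i • (y δ i - k δ i - L (g δ i))
        + L (∑ i, ε i • g δ i)) := by
      rw [map_sum, ← Finset.sum_add_distrib, ← Finset.sum_add_distrib]
      refine Finset.sum_congr rfl fun i _ => ?_
      rw [map_units_smul, ← smul_add, ← smul_add]
      congr 1
      abel
    have e2 : p (∑ i, ε i • (y δ i - k δ i - L (g δ i))) ≤ 0 := by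
      refine (Finset.le_sum_of_subadditive p (map_zero p).le (map_add_le_add p) _ _).trans ?_
      refine le_of_eq (Finset.sum_eq_zero fun i _ => ?_)
      rw [seminorm_units_smul, hgL]
    rw [e1]
    have e3 := map_add_le_add p (∑ i, ε i • k δ i) (∑ i, ε i • (y δ i - k δ i - L (g δ i))
        + L (∑ i, ε i • g δ i))
    have e4 := map_add_le_add p (∑ i, ε i • (y δ i - k δ i - L (g δ i)))
      (L (∑ i, ε i • g δ i))
    linarith [hL (∑ i, ε i • g δ i)]
  -- The type 2 inequality is applied in `ε` to the lifts, whose seminorms are those of `q (y δ i)`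
  -- up to `1 + η`. The average over `δ` is then exact in `H`, so `A` is lost only by the factor `1
  -- + η`.
  have hfirst : ∑ w : (ι → ℤˣ) × (ι → ℤˣ), p (∑ i, w.2 i • k w.1 i) ^ 2
      ≤ ((1 + η) * A * (M * √S)) ^ 2 := by
    rw [Fintype.sum_prod_type]
    calc _ ≤ ∑ δ : ι → ℤˣ, A ^ 2 * (M * ∑ i, (1 + η) ^ 2 * ‖q (y δ i)‖ ^ 2) := by
          refine Finset.sum_le_sum fun δ _ => (h (k δ)).trans ?_
          gcongr with i
          rw [← mul_pow]
          exact pow_le_pow_left₀ (apply_nonneg _ _) (hkp δ i) 2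
      _ = A ^ 2 * (M * ((1 + η) ^ 2 * ∑ i, ∑ δ : ι → ℤˣ, ‖q (y δ i)‖ ^ 2)) := by
          rw [← Finset.mul_sum, ← Finset.mul_sum, Finset.sum_comm, Finset.mul_sum]
          simp only [Finset.mul_sum]
      _ ≤ A ^ 2 * (M * ((1 + η) ^ 2 * (M * S))) := by
          gcongr
          rw [hSs, Finset.mul_sum]
          refine Finset.sum_le_sum fun i _ => ?_
          have : ∀ δ : ι → ℤˣ, q (y δ i) = q (x (Sum.inl i)) + δ i • q (x (Sum.inr i)) :=
            fun δ => by rw [map_add, map_units_smul]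
          simp only [this]
          rw [sum_signs_norm_add_sq]
          gcongr <;> exact hq _
      _ = _ := by rw [mul_pow, mul_pow, mul_pow, Real.sq_sqrt hS0]; ring
  -- For the kernel part the crude bound on `g δ i`, uniform in `δ`, suffices; `√18 ≤ 5` explains
  -- the constant 5.
  have hsecond : ∑ w : (ι → ℤˣ) × (ι → ℤˣ), (C * p' (∑ i, w.2 i • g w.1 i)) ^ 2
      ≤ (5 * C ^ 2 * A' * (M * √S)) ^ 2 := by
    rw [Fintype.sum_prod_type]
    calc _ ≤ ∑ δ : ι → ℤˣ, C ^ 2 * (A' ^ 2 * (M * (18 * C ^ 2 * S))) := by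
          refine Finset.sum_le_sum fun δ _ => ?_
          simp only [mul_pow]
          rw [← Finset.mul_sum]
          refine mul_le_mul_of_nonneg_left ((h' (g δ)).trans ?_) (sq_nonneg _)
          gcongr
          rw [hSs, Finset.mul_sum]
          exact Finset.sum_le_sum fun i _ => hg δ i
      _ = 18 * (C ^ 4 * A' ^ 2 * M ^ 2 * S) := by
          rw [Finset.sum_const, Finset.card_univ, nsmul_eq_mul, card_signs]; ring
      _ ≤ 25 * (C ^ 4 * A' ^ 2 * M ^ 2 * S) := by gcongr; norm_num
      _ = _ := by rw [mul_pow, mul_pow M, Real.sq_sqrt hS0]; ring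
  have hA0 : 0 ≤ (1 + η) * A * (M * √S) := by positivity
  have hB0 : 0 ≤ 5 * C ^ 2 * A' * (M * √S) := by positivity
  have := sum_add_sq_le Finset.univ _ _ hA0 hB0 hfirst hsecond
  rw [← Fintype.sum_prod_type' (fun δ ε : ι → ℤˣ => p (∑ i, ε i • y δ i) ^ 2)]
  calc _ ≤ _ := (Finset.sum_le_sum fun w _ =>
          pow_le_pow_left₀ (apply_nonneg _ _) (hpt w.1 w.2) 2).trans this
    _ = _ := by rw [← add_mul, mul_pow, mul_pow M, Real.sq_sqrt hS0]; ring

/-- A family of seminorms, each one a twisted sum of a Hilbert space with the preceding one, has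
type 2 constants that grow at most like powers of the logarithm of the size of the family. -/
theorem exists_hasTypeTwo (p : ℕ → Seminorm ℂ E) (q : E →ₗ[ℂ] H) (L : E →ₗ[ℂ] E) {C : ℝ}
    (hC : 0 ≤ C) (h0 : ∀ f, p 0 f = 0) (hq : ∀ m f, ‖q f‖ ≤ p (m + 1) f)
    (hlift : ∀ m y, ∀ η : ℝ, 0 < η → ∃ h, q h = q y ∧ p (m + 1) h ≤ (1 + η) * ‖q y‖)
    (hker : ∀ m f, q f = 0 → ∃ g, p (m + 1) (f - L g) = 0 ∧ p m g ≤ C * p (m + 1) f)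
    (hL : ∀ m g, p (m + 1) (L g) ≤ C * p m g) (m : ℕ) :
    ∃ D : ℝ, 0 ≤ D ∧ ∀ k : ℕ, HasTypeTwo (p m) (Fin (2 ^ k)) (D * (k + 1) ^ (m - 1)) := by
  induction m with
  | zero => exact ⟨0, le_rfl, fun k x => by simp [h0]⟩
  | succ m ih =>
    obtain ⟨D, hD, hk⟩ := ih
    -- At `m = 0` the truncated exponent `m - 1` is `0`, and summing the constant `D` would produce
    -- a spurious factor `k`. Since `p 0` vanishes, the constant `0` is used there.
    have hk' : ∀ k : ℕ, ∃ B : ℝ, 0 ≤ B ∧ B ≤ D * (k + 1) ^ (m - 1) ∧ (m = 0 → B = 0) ∧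
        HasTypeTwo (p m) (Fin (2 ^ k)) B := by
      intro k
      rcases Nat.eq_zero_or_pos m with rfl | hm
      · exact ⟨0, le_rfl, by positivity, fun _ => rfl, fun x => by simp [h0]⟩
      · exact ⟨_, by positivity, le_rfl, fun h => absurd h hm.ne', hk k⟩
    choose B hB0 hBle hBz hBT using hk'
    have key : ∀ k : ℕ, HasTypeTwo (p (m + 1)) (Fin (2 ^ k))
        (1 + 5 * C ^ 2 * ∑ i ∈ Finset.range k, B i) := by
      intro k
      induction k with
      -- A single vector has type 2 constant one.
      | zero =>
        intro x
        refine le_of_eq ?_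
        have : ∀ ε : Fin (2 ^ 0) → ℤˣ, p (m + 1) (∑ i, ε i • x i) = p (m + 1) (x 0) := by
          intro ε
          rw [show (∑ i, ε i • x i) = ε 0 • x 0 from Fin.sum_univ_one _, seminorm_units_smul]
        simp only [this, Finset.sum_const, Finset.card_univ, nsmul_eq_mul, card_signs]
        simp
      | succ k ihk =>
        have hS : 0 ≤ ∑ i ∈ Finset.range k, B i := Finset.sum_nonneg fun i _ => hB0 i
        have := HasTypeTwo.sum q L hC (hq m) (hlift m) (hker m) (hL m)
          (by positivity) (hB0 k) ihk (hBT k)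
        rw [Finset.sum_range_succ, mul_add, ← add_assoc]
        exact this.of_equiv (finSumFinEquiv.trans (finCongr (by rw [pow_succ, mul_two])))
    refine ⟨1 + 5 * C ^ 2 * D, by positivity, fun k => (key k).mono ?_ ?_⟩
    · have : 0 ≤ ∑ i ∈ Finset.range k, B i := Finset.sum_nonneg fun i _ => hB0 i
      positivity
    · rw [Nat.add_sub_cancel, add_mul, one_mul, mul_assoc _ D]
      refine add_le_add (one_le_pow₀ (by simp)) (mul_le_mul_of_nonneg_left ?_ (by positivity))
      rcases Nat.eq_zero_or_pos m with rfl | hm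
      · rw [Finset.sum_eq_zero fun i _ => hBz i rfl]
        positivity
      · calc ∑ i ∈ Finset.range k, B i ≤ ∑ i ∈ Finset.range k, D * (k + 1) ^ (m - 1) := by
              refine Finset.sum_le_sum fun i hi => (hBle i).trans ?_
              have : (i : ℝ) ≤ k := by exact_mod_cast (Finset.mem_range.1 hi).le
              gcongr
          _ = D * (k * (k + 1) ^ (m - 1)) := by
              rw [Finset.sum_const, Finset.card_range, nsmul_eq_mul]; ring
          _ ≤ D * ((k + 1) * (k + 1) ^ (m - 1)) := by gcongr; linarith
          _ = D * (k + 1) ^ m := by rw [← pow_succ', Nat.sub_add_cancel hm]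

end Rademacher

/-! ### Multiplication and division by a function with a zero at `1/2`, for a general couple. -/

theorem half_coe : ((half : verticalStrip 0 1) : ℂ) = 1 / 2 := rfl

theorem continuous_leftPt : Continuous leftPt := by
  unfold leftPt; fun_prop

theorem continuous_rightPt : Continuous rightPt := by
  unfold rightPt; fun_prop

namespace Calderon

section General

variable {X₀ X₁ E : Type*}
  [NormedAddCommGroup X₀] [NormedSpace ℂ X₀] [NormedAddCommGroup X₁] [NormedSpace ℂ X₁]
  [NormedAddCommGroup E] [NormedSpace ℂ E]
variable {ι₀ : X₀ →L[ℂ] E} {ι₁ : X₁ →L[ℂ] E}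

theorem strip_mem_nhds {z : ℂ} (hz : z ∈ verticalStrip 0 1) : verticalStrip 0 1 ∈ nhds z :=
  isOpen_strip.mem_nhds hz

theorem toFun_apply (f : Calderon ι₀ ι₁) {z : ℂ} (hz : z ∈ verticalClosedStrip 0 1) :
    f.toFun z = f.1.1 ⟨z, hz⟩ := stripExt_apply _ hz

theorem continuousOn_toFun (f : Calderon ι₀ ι₁) :
    ContinuousOn f.toFun (verticalClosedStrip 0 1) := by
  rw [continuousOn_iff_continuous_domRestrict]
  have : (verticalClosedStrip 0 1).domRestrict f.toFun = f.1.1 := by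
    funext w
    exact stripExt_apply _ w.2
  rw [this]
  exact f.1.1.continuous

theorem toFun_left (f : Calderon ι₀ ι₁) (t : ℝ) :
    f.toFun (t * Complex.I) = ι₀ ((boundary f).1 t) :=
  (f.toFun_apply (leftPt t).2).trans (f.2.2.1 t)

theorem toFun_right (f : Calderon ι₀ ι₁) (t : ℝ) :
    f.toFun (1 + t * Complex.I) = ι₁ ((boundary f).2 t) :=
  (f.toFun_apply (rightPt t).2).trans (f.2.2.2 t)

theorem norm_eq (f : Calderon ι₀ ι₁) : ‖f‖ = ‖boundary f‖ := rfl

theorem norm_left_le (f : Calderon ι₀ ι₁) (t : ℝ) : ‖(boundary f).1 t‖ ≤ ‖f‖ :=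
  ((boundary f).1.norm_coe_le_norm t).trans (norm_fst_le (boundary f))

theorem norm_right_le (f : Calderon ι₀ ι₁) (t : ℝ) : ‖(boundary f).2 t‖ ≤ ‖f‖ :=
  ((boundary f).2.norm_coe_le_norm t).trans (norm_snd_le (boundary f))

theorem norm_le_of_boundary {f : Calderon ι₀ ι₁} {C : ℝ} (hC : 0 ≤ C)
    (h0 : ∀ t, ‖(boundary f).1 t‖ ≤ C) (h1 : ∀ t, ‖(boundary f).2 t‖ ≤ C) : ‖f‖ ≤ C := by
  rw [norm_eq, Prod.norm_def]
  exact max_le ((BoundedContinuousFunction.norm_le hC).2 h0)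
    ((BoundedContinuousFunction.norm_le hC).2 h1)

/-- A function on the closed strip as an element of the Calderón space. -/
def ofFun (F : ℂ → E) (hd : DifferentiableOn ℂ F (verticalStrip 0 1))
    (hc : ContinuousOn F (verticalClosedStrip 0 1)) (M : ℝ)
    (hM : ∀ z ∈ verticalClosedStrip 0 1, ‖F z‖ ≤ M) (g₀ : ℝ →ᵇ X₀) (g₁ : ℝ →ᵇ X₁)
    (h₀ : ∀ t : ℝ, F (t * Complex.I) = ι₀ (g₀ t))
    (h₁ : ∀ t : ℝ, F (1 + t * Complex.I) = ι₁ (g₁ t)) : Calderon ι₀ ι₁ :=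
  ⟨(BoundedContinuousFunction.ofNormedAddCommGroup ((verticalClosedStrip 0 1).domRestrict F)
      (continuousOn_iff_continuous_domRestrict.1 hc) M (fun _ => hM _ (Subtype.prop _)), g₀, g₁),
    hd.congr fun _ hz => stripExt_apply _ (strip_subset hz), h₀, h₁⟩

theorem toFun_ofFun {F : ℂ → E} {hd hc M hM g₀ g₁ h₀ h₁} {z : ℂ}
    (hz : z ∈ verticalClosedStrip 0 1) :
    (ofFun (ι₀ := ι₀) (ι₁ := ι₁) F hd hc M hM g₀ g₁ h₀ h₁).toFun z = F z :=
  stripExt_apply _ hz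

theorem boundary_ofFun {F : ℂ → E} {hd hc M hM g₀ g₁ h₀ h₁} :
    boundary (ofFun (ι₀ := ι₀) (ι₁ := ι₁) F hd hc M hM g₀ g₁ h₀ h₁) = (g₀, g₁) := rfl

/-- By the maximum principle the boundary norm is equivalent to that of the ambient product, where
the space is closed because uniform limits of analytic functions are analytic. Completeness is what
later allows lifts to be extended from finitely supported sequences to all of `ℓ₂`. -/
instance [CompleteSpace X₀] [CompleteSpace X₁] [CompleteSpace E] :
    CompleteSpace (Calderon ι₀ ι₁) := by
  let j : Calderon ι₀ ι₁ →ₗ[ℂ] (verticalClosedStrip 0 1 →ᵇ E) × (ℝ →ᵇ X₀) × (ℝ →ᵇ X₁) :=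
    (calderonSubmodule ι₀ ι₁).subtype
  have hlip : LipschitzWith (max ‖ι₀‖₊ ‖ι₁‖₊ + 1) j := by
    refine AddMonoidHomClass.lipschitz_of_bound_nnnorm j _ fun f => ?_
    rw [Prod.nnnorm_def]
    refine max_le ?_ ?_
    · rw [← NNReal.coe_le_coe]
      refine (BoundedContinuousFunction.norm_le (by positivity)).2 fun z => ?_
      have := f.norm_toFun_le z.2
      rw [toFun_apply f z.2] at this
      refine this.trans ?_
      rw [← norm_eq]
      push_cast
      gcongr
      simp
    · change ‖f‖₊ ≤ _
      exact le_mul_of_one_le_left zero_le (by simp)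
  have hanti : AntilipschitzWith 1 j := by
    refine AddMonoidHomClass.antilipschitz_of_bound j fun f => ?_
    rw [NNReal.coe_one, one_mul]
    exact norm_snd_le (j f)
  have hui : IsUniformInducing j := hanti.isUniformInducing hlip.uniformContinuous
  rw [completeSpace_iff_isComplete_range hui]
  have hrange : Set.range j = (calderonSubmodule ι₀ ι₁ : Set _) := Subtype.range_coe
  rw [hrange]
  refine IsClosed.isComplete ?_
  refine isClosed_of_closure_subset fun p hp => ?_
  obtain ⟨u, hu, hlim⟩ := mem_closure_iff_seq_limit.1 hp
  have h1 : Filter.Tendsto (fun n => (u n).1) Filter.atTop (nhds p.1) :=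
    (continuous_fst.tendsto p).comp hlim
  have h2 : Filter.Tendsto (fun n => (u n).2.1) Filter.atTop (nhds p.2.1) :=
    ((continuous_fst.comp continuous_snd).tendsto p).comp hlim
  have h3 : Filter.Tendsto (fun n => (u n).2.2) Filter.atTop (nhds p.2.2) :=
    ((continuous_snd.comp continuous_snd).tendsto p).comp hlim
  refine ⟨?_, fun t => ?_, fun t => ?_⟩
  · have hloc : TendstoLocallyUniformlyOn (fun n => stripExt (u n).1) (stripExt p.1) Filter.atTop
        (verticalStrip 0 1) := by
      refine TendstoUniformlyOn.tendstoLocallyUniformlyOn ?_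
      rw [Metric.tendstoUniformlyOn_iff]
      intro ε hε
      have := BoundedContinuousFunction.tendsto_iff_tendstoUniformly.1 h1
      filter_upwards [Metric.tendstoUniformly_iff.1 this ε hε] with n hn z hz
      rw [stripExt_apply _ (strip_subset hz), stripExt_apply _ (strip_subset hz)]
      exact hn _
    exact hloc.differentiableOn (Filter.Eventually.of_forall fun n => (hu n).1) isOpen_strip
  · refine tendsto_nhds_unique
      (((BoundedContinuousFunction.lipschitz_eval_const (leftPt t)).continuous.tendsto _).comp h1) ?_
    have : Filter.Tendsto (fun n => ι₀ ((u n).2.1 t)) Filter.atTop (nhds (ι₀ (p.2.1 t))) :=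
      (ι₀.continuous.tendsto _).comp
        (((BoundedContinuousFunction.lipschitz_eval_const t).continuous.tendsto _).comp h2)
    exact this.congr fun n => ((hu n).2.1 t).symm
  · refine tendsto_nhds_unique
      (((BoundedContinuousFunction.lipschitz_eval_const (rightPt t)).continuous.tendsto _).comp h1) ?_
    have : Filter.Tendsto (fun n => ι₁ ((u n).2.2 t)) Filter.atTop (nhds (ι₁ (p.2.2 t))) :=
      (ι₁.continuous.tendsto _).comp
        (((BoundedContinuousFunction.lipschitz_eval_const t).continuous.tendsto _).comp h3)
    exact this.congr fun n => ((hu n).2.2 t).symm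

/-- Multiplication by a bounded analytic scalar function. -/
def mulLeft (c : verticalClosedStrip 0 1 →ᵇ ℂ)
    (hc : DifferentiableOn ℂ (stripExt c) (verticalStrip 0 1)) :
    Calderon ι₀ ι₁ →ₗ[ℂ] Calderon ι₀ ι₁ where
  toFun f := ⟨(c • f.1.1, c.compContinuous ⟨leftPt, continuous_leftPt⟩ • f.1.2.1,
      c.compContinuous ⟨rightPt, continuous_rightPt⟩ • f.1.2.2), by
    refine ⟨(hc.smul f.differentiableOn).congr fun z hz => ?_, fun t => ?_, fun t => ?_⟩
    · have hz' := strip_subset hz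
      rw [stripExt_apply _ hz', Pi.smul_apply', stripExt_apply _ hz', toFun_apply f hz']
      rfl
    · change c (leftPt t) • f.1.1 (leftPt t) = ι₀ (c (leftPt t) • f.1.2.1 t)
      rw [f.2.2.1 t, map_smul]
    · change c (rightPt t) • f.1.1 (rightPt t) = ι₁ (c (rightPt t) • f.1.2.2 t)
      rw [f.2.2.2 t, map_smul]⟩
  map_add' f g := Subtype.ext <| Prod.ext (smul_add c f.1.1 g.1.1)
    (Prod.ext (smul_add _ f.1.2.1 g.1.2.1) (smul_add _ f.1.2.2 g.1.2.2))
  map_smul' a f := Subtype.ext <| Prod.ext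
    (BoundedContinuousFunction.ext fun _ => smul_comm _ a _)
    (Prod.ext (BoundedContinuousFunction.ext fun _ => smul_comm _ a _)
      (BoundedContinuousFunction.ext fun _ => smul_comm _ a _))

theorem toFun_mulLeft (c : verticalClosedStrip 0 1 →ᵇ ℂ)
    (hc : DifferentiableOn ℂ (stripExt c) (verticalStrip 0 1)) (f : Calderon ι₀ ι₁) {z : ℂ}
    (hz : z ∈ verticalClosedStrip 0 1) : (mulLeft c hc f).toFun z = c ⟨z, hz⟩ • f.toFun z := by
  rw [toFun_apply f hz, toFun_apply _ hz]
  rfl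

theorem boundary_mulLeft_fst (c : verticalClosedStrip 0 1 →ᵇ ℂ)
    (hc : DifferentiableOn ℂ (stripExt c) (verticalStrip 0 1)) (f : Calderon ι₀ ι₁) (t : ℝ) :
    (boundary (mulLeft c hc f)).1 t = c (leftPt t) • (boundary f).1 t := rfl

theorem boundary_mulLeft_snd (c : verticalClosedStrip 0 1 →ᵇ ℂ)
    (hc : DifferentiableOn ℂ (stripExt c) (verticalStrip 0 1)) (f : Calderon ι₀ ι₁) (t : ℝ) :
    (boundary (mulLeft c hc f)).2 t = c (rightPt t) • (boundary f).2 t := rfl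

theorem norm_mulLeft_le (c : verticalClosedStrip 0 1 →ᵇ ℂ)
    (hc : DifferentiableOn ℂ (stripExt c) (verticalStrip 0 1)) (f : Calderon ι₀ ι₁) :
    ‖mulLeft c hc f‖ ≤ ‖c‖ * ‖f‖ := by
  refine norm_le_of_boundary (by positivity) (fun t => ?_) (fun t => ?_)
  · rw [boundary_mulLeft_fst, norm_smul]
    exact mul_le_mul (c.norm_coe_le_norm _) (f.norm_left_le t) (norm_nonneg _) (norm_nonneg _)
  · rw [boundary_mulLeft_snd, norm_smul]
    exact mul_le_mul (c.norm_coe_le_norm _) (f.norm_right_le t) (norm_nonneg _) (norm_nonneg _)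

theorem add_one_ne_zero_of_mem {z : ℂ} (hz : z ∈ verticalClosedStrip 0 1) : z + 1 ≠ 0 := by
  intro h
  have h1 : (z + 1).re = 0 := by rw [h]; simp
  have h2 : 0 ≤ z.re := hz.1
  simp at h1
  linarith

theorem norm_sub_half_le {z : ℂ} (hz : z ∈ verticalClosedStrip 0 1) :
    ‖z - 1 / 2‖ ≤ ‖z + 1‖ := by
  have h2 : 0 ≤ z.re := hz.1
  rw [← sq_le_sq₀ (norm_nonneg _) (norm_nonneg _), Complex.sq_norm, Complex.sq_norm,
    Complex.normSq_apply, Complex.normSq_apply]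
  simp
  nlinarith

/-- The boundary lines lie at distance at least `1/2` from `1/2`, so division by `halfZero` costs
there a factor of at most 4. -/
theorem norm_add_one_le {z : ℂ} (hz : 1 / 2 ≤ ‖z - 1 / 2‖) : ‖z + 1‖ ≤ 4 * ‖z - 1 / 2‖ := by
  have : z + 1 = (z - 1 / 2) + (3 / 2 : ℂ) := by ring
  have h3 : ‖(3 / 2 : ℂ)‖ = 3 / 2 := by norm_num
  rw [this]
  refine (norm_add_le _ _).trans ?_
  rw [h3]
  linarith

/-- The bounded function `(z - 1/2) / (z + 1)` on the strip, with a simple zero at `1/2`. -/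
def halfZero : verticalClosedStrip 0 1 →ᵇ ℂ :=
  BoundedContinuousFunction.ofNormedAddCommGroup (fun z => ((z : ℂ) - 1 / 2) / ((z : ℂ) + 1))
    (Continuous.div (by fun_prop) (by fun_prop) fun z => add_one_ne_zero_of_mem z.2) 1 (fun z => by
      rw [norm_div]
      exact div_le_one_of_le₀ (norm_sub_half_le z.2) (norm_nonneg _))

theorem halfZero_apply (z : verticalClosedStrip 0 1) :
    halfZero z = ((z : ℂ) - 1 / 2) / ((z : ℂ) + 1) := rfl

theorem norm_halfZero_le : ‖halfZero‖ ≤ 1 :=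
  BoundedContinuousFunction.norm_ofNormedAddCommGroup_le _ zero_le_one _

theorem differentiableOn_halfZero : DifferentiableOn ℂ (stripExt halfZero) (verticalStrip 0 1) := by
  have : DifferentiableOn ℂ (fun z : ℂ => (z - 1 / 2) / (z + 1)) (verticalStrip 0 1) :=
    DifferentiableOn.div (by fun_prop) (by fun_prop)
      fun z hz => add_one_ne_zero_of_mem (strip_subset hz)
  exact this.congr fun z hz => stripExt_apply _ (strip_subset hz)

theorem half_le_norm_sub_half_of_re {z : ℂ} (hz : z.re = 0 ∨ z.re = 1) :
    1 / 2 ≤ ‖z - 1 / 2‖ := by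
  refine le_trans ?_ (Complex.abs_re_le_norm _)
  rcases hz with h | h <;> norm_num [h]

/-- Functions vanishing at `1/2` are divisible by `halfZero`. -/
theorem exists_mulLeft_halfZero_eq (f : Calderon ι₀ ι₁) [CompleteSpace E]
    (hf : f.toFun (1 / 2) = 0) :
    ∃ g : Calderon ι₀ ι₁, mulLeft halfZero differentiableOn_halfZero g = f ∧ ‖g‖ ≤ 4 * ‖f‖ := by
  -- This is `f / halfZero` with its singularity at `1/2` removed.
  set F : ℂ → E := fun z => (z + 1) • dslope f.toFun (1 / 2) z with hF
  have hmem : (verticalStrip 0 1) ∈ nhds (1 / 2 : ℂ) := strip_mem_nhds half.2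
  have hFne : ∀ z : ℂ, z ≠ 1 / 2 → F z = ((z + 1) / (z - 1 / 2)) • f.toFun z := by
    intro z hz
    rw [hF]
    simp only
    rw [dslope_of_ne _ hz, slope_def_module, hf, sub_zero, smul_smul, ← div_eq_mul_inv]
  have hd : DifferentiableOn ℂ F (verticalStrip 0 1) :=
    DifferentiableOn.smul (by fun_prop)
      ((Complex.differentiableOn_dslope hmem).2 f.differentiableOn)
  have hc : ContinuousOn F (verticalClosedStrip 0 1) := by
    refine ContinuousOn.smul (by fun_prop) ?_
    rw [continuousOn_dslope (Filter.mem_of_superset hmem strip_subset)]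
    exact ⟨f.continuousOn_toFun, f.differentiableOn.differentiableAt hmem⟩
  have hbig : ∀ z : ℂ, 1 / 2 ≤ ‖z - 1 / 2‖ → ‖(z + 1) / (z - 1 / 2)‖ ≤ 4 := by
    intro z hz
    rw [norm_div, div_le_iff₀ (by linarith)]
    exact norm_add_one_le hz
  have hne : ∀ z : ℂ, 1 / 2 ≤ ‖z - 1 / 2‖ → z ≠ 1 / 2 := by
    rintro z hz rfl
    simp at hz
    linarith
  have hball : Metric.closedBall (1 / 2 : ℂ) (1 / 2) ⊆ verticalClosedStrip 0 1 := by
    intro z hz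
    have h1 := (Complex.abs_re_le_norm (z - 1 / 2)).trans (mem_closedBall_iff_norm.1 hz)
    rw [abs_le] at h1
    simp at h1
    constructor <;> linarith [h1.1, h1.2]
  -- Near `1/2` only some bound is needed, to make `F` a member of the space; its norm is read off
  -- from the boundary.
  obtain ⟨M, hM⟩ := (isCompact_closedBall (1 / 2 : ℂ) (1 / 2)).exists_bound_of_continuousOn
    (hc.mono hball)
  have hbd : ∀ z ∈ verticalClosedStrip 0 1, ‖F z‖ ≤ max M (4 * ‖f.1.1‖) := by
    intro z hz
    rcases le_or_gt ‖z - 1 / 2‖ (1 / 2) with h | h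
    · exact (hM z (mem_closedBall_iff_norm.2 h)).trans (le_max_left _ _)
    · refine le_trans ?_ (le_max_right _ _)
      rw [hFne z (hne z h.le), norm_smul, toFun_apply f hz]
      exact mul_le_mul (hbig z h.le) (f.1.1.norm_coe_le_norm _) (norm_nonneg _) (by norm_num)
  have hl : ∀ t : ℝ, 1 / 2 ≤ ‖(t * Complex.I : ℂ) - 1 / 2‖ := fun t =>
    half_le_norm_sub_half_of_re (by simp)
  have hr : ∀ t : ℝ, 1 / 2 ≤ ‖(1 + t * Complex.I : ℂ) - 1 / 2‖ := fun t =>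
    half_le_norm_sub_half_of_re (by simp)
  have hbl : ∀ t : ℝ, ‖((t * Complex.I + 1 : ℂ) / (t * Complex.I - 1 / 2)) • (boundary f).1 t‖
      ≤ 4 * ‖f‖ := fun t => by
    rw [norm_smul]
    exact mul_le_mul (hbig _ (hl t)) (f.norm_left_le t) (norm_nonneg _) (by norm_num)
  have hbr : ∀ t : ℝ, ‖((1 + t * Complex.I + 1 : ℂ) / (1 + t * Complex.I - 1 / 2)) •
      (boundary f).2 t‖ ≤ 4 * ‖f‖ := fun t => by
    rw [norm_smul]
    exact mul_le_mul (hbig _ (hr t)) (f.norm_right_le t) (norm_nonneg _) (by norm_num)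
  let g₀ : ℝ →ᵇ X₀ := BoundedContinuousFunction.ofNormedAddCommGroup
    (fun t : ℝ => ((t * Complex.I + 1 : ℂ) / (t * Complex.I - 1 / 2)) • (boundary f).1 t)
    (Continuous.smul (Continuous.div (by fun_prop) (by fun_prop)
      fun t => sub_ne_zero.2 (hne _ (hl t))) (by fun_prop)) _ hbl
  let g₁ : ℝ →ᵇ X₁ := BoundedContinuousFunction.ofNormedAddCommGroup
    (fun t : ℝ => ((1 + t * Complex.I + 1 : ℂ) / (1 + t * Complex.I - 1 / 2)) • (boundary f).2 t)
    (Continuous.smul (Continuous.div (by fun_prop) (by fun_prop)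
      fun t => sub_ne_zero.2 (hne _ (hr t))) (by fun_prop)) _ hbr
  refine ⟨ofFun F hd hc _ hbd g₀ g₁ (fun t => ?_) (fun t => ?_), ?_, ?_⟩
  · rw [hFne _ (hne _ (hl t)), toFun_left, ← map_smul]
    rfl
  · rw [hFne _ (hne _ (hr t)), toFun_right, ← map_smul]
    rfl
  · refine boundary_injective (Prod.ext ?_ ?_)
    · ext1 t
      rw [boundary_mulLeft_fst, boundary_ofFun]
      change halfZero (leftPt t) • (((t * Complex.I + 1 : ℂ) / (t * Complex.I - 1 / 2)) •
        (boundary f).1 t) = _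
      rw [smul_smul, halfZero_apply]
      have h1 := sub_ne_zero.2 (hne _ (hl t))
      have h2 := add_one_ne_zero_of_mem (leftPt t).2
      simp only [leftPt] at h2 ⊢
      rw [div_mul_div_cancel₀ h2, div_self h1, one_smul]
    · ext1 t
      rw [boundary_mulLeft_snd, boundary_ofFun]
      change halfZero (rightPt t) • (((1 + t * Complex.I + 1 : ℂ) / (1 + t * Complex.I - 1 / 2)) •
        (boundary f).2 t) = _
      rw [smul_smul, halfZero_apply]
      have h1 := sub_ne_zero.2 (hne _ (hr t))
      have h2 := add_one_ne_zero_of_mem (rightPt t).2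
      simp only [rightPt] at h2 ⊢
      rw [div_mul_div_cancel₀ h2, div_self h1, one_smul]
  · exact norm_le_of_boundary (by positivity) hbl hbr

variable [CompleteSpace E]

theorem analyticAt_toFun (f : Calderon ι₀ ι₁) {z : ℂ} (hz : z ∈ verticalStrip 0 1) :
    AnalyticAt ℂ f.toFun z :=
  f.differentiableOn.analyticAt (strip_mem_nhds hz)

/-- The order of vanishing is additive under products, which spares the Leibniz rule for Taylor
coefficients. -/
theorem taylor_eq_zero_iff (f : Calderon ι₀ ι₁) (z : verticalStrip 0 1) (n : ℕ) :
    taylor z n f = 0 ↔ (n : ℕ∞) ≤ analyticOrderAt f.toFun z := by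
  rw [natCast_le_analyticOrderAt_iff_iteratedDeriv_eq_zero (f.analyticAt_toFun z.2), funext_iff]
  have : ∀ i : Fin n, taylor z n f i = 0 ↔ iteratedDeriv i f.toFun z = 0 := by
    intro i
    change ((Nat.factorial i : ℂ))⁻¹ • iteratedDeriv i f.toFun z = 0 ↔ _
    rw [smul_eq_zero_iff_right (inv_ne_zero (by exact_mod_cast Nat.factorial_ne_zero _))]
  simp only [Pi.zero_apply, this]
  exact ⟨fun h i hi => h ⟨i, hi⟩, fun h i => h i i.2⟩

theorem taylor_mulLeft_halfZero {f : Calderon ι₀ ι₁} {n : ℕ} (hf : taylor half n f = 0) :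
    taylor half (n + 1) (mulLeft halfZero differentiableOn_halfZero f) = 0 := by
  rw [taylor_eq_zero_iff] at hf ⊢
  have hc : AnalyticAt ℂ (stripExt halfZero) half :=
    differentiableOn_halfZero.analyticAt (strip_mem_nhds half.2)
  have heq : (mulLeft halfZero differentiableOn_halfZero f).toFun =ᶠ[nhds (half : ℂ)]
      stripExt halfZero • f.toFun := by
    filter_upwards [strip_mem_nhds half.2] with z hz
    rw [toFun_mulLeft _ _ _ (strip_subset hz), Pi.smul_apply',
      stripExt_apply _ (strip_subset hz)]
  rw [analyticOrderAt_congr heq, analyticOrderAt_smul hc (f.analyticAt_toFun half.2),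
    Nat.cast_add, add_comm, Nat.cast_one]
  refine add_le_add ?_ hf
  rw [Order.one_le_iff_ne_zero, hc.analyticOrderAt_ne_zero, stripExt_apply _ (strip_subset half.2),
    halfZero_apply]
  simp [half_coe]

end General

end Calderon

/-! ### Rochberg spaces as quotients, and the kernel of evaluation at `1/2`. -/

namespace RochbergSpace

open Calderon

variable {X₀ X₁ E : Type*}
  [NormedAddCommGroup X₀] [NormedSpace ℂ X₀] [NormedAddCommGroup X₁] [NormedSpace ℂ X₁]
  [NormedAddCommGroup E] [NormedSpace ℂ E] [CompleteSpace E]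
variable {ι₀ : X₀ →L[ℂ] E} {ι₁ : X₁ →L[ℂ] E}

/-- The quotient map from the Calderón space to the Rochberg space. -/
def mk (z : verticalStrip 0 1) (n : ℕ) : Calderon ι₀ ι₁ →ₗ[ℂ] RochbergSpace ι₀ ι₁ z n :=
  (taylor (ι₀ := ι₀) (ι₁ := ι₁) z n).toLinearMap.rangeRestrict

theorem mk_surjective (z : verticalStrip 0 1) (n : ℕ) :
    Function.Surjective (mk (ι₀ := ι₀) (ι₁ := ι₁) z n) :=
  LinearMap.surjective_rangeRestrict _

theorem mk_eq_zero_iff {z : verticalStrip 0 1} {n : ℕ} {f : Calderon ι₀ ι₁} :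
    mk z n f = 0 ↔ taylor z n f = 0 :=
  Subtype.ext_iff

theorem norm_mk_le (z : verticalStrip 0 1) (n : ℕ) (f : Calderon ι₀ ι₁) : ‖mk z n f‖ ≤ ‖f‖ := by
  rw [norm_def]
  exact csInf_le ⟨0, by rintro _ ⟨g, -, rfl⟩; exact norm_nonneg g⟩ ⟨f, rfl, rfl⟩

theorem exists_norm_lt (z : verticalStrip 0 1) (n : ℕ) (f : Calderon ι₀ ι₁) {C : ℝ}
    (hC : ‖mk z n f‖ < C) : ∃ g : Calderon ι₀ ι₁, taylor z n (f - g) = 0 ∧ ‖g‖ < C := by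
  rw [norm_def] at hC
  obtain ⟨_, ⟨g, hg, rfl⟩, hlt⟩ := exists_lt_of_csInf_lt
    (Set.Nonempty.image norm (s := {g | taylor z n g = (mk z n f).1}) ⟨f, rfl⟩) hC
  refine ⟨g, ?_, hlt⟩
  rw [map_sub, sub_eq_zero]
  exact hg.symm

/-- The seminorm of the Rochberg space, on the Calderón space. -/
def mkSeminorm (ι₀ : X₀ →L[ℂ] E) (ι₁ : X₁ →L[ℂ] E) (z : verticalStrip 0 1) (n : ℕ) :
    Seminorm ℂ (Calderon ι₀ ι₁) :=
  (normSeminorm ℂ (RochbergSpace ι₀ ι₁ z n)).comp (mk z n)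

theorem mkSeminorm_apply (z : verticalStrip 0 1) (n : ℕ) (f : Calderon ι₀ ι₁) :
    mkSeminorm ι₀ ι₁ z n f = ‖mk z n f‖ := rfl

theorem mk_eq_of_taylor_sub {z : verticalStrip 0 1} {n : ℕ} {f g : Calderon ι₀ ι₁}
    (h : taylor z n (f - g) = 0) : mk z n f = mk z n g := by
  rw [← sub_eq_zero, ← map_sub]
  exact mk_eq_zero_iff.2 h

/-- Multiplication by `halfZero` is a contraction that raises the order of vanishing at `1/2` by at
least one, so it descends to the quotients. It embeds the kernel of the twisted sum. -/
theorem norm_mk_mulLeft_halfZero_le (n : ℕ) (g : Calderon ι₀ ι₁) :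
    ‖mk half (n + 1) (mulLeft halfZero differentiableOn_halfZero g)‖ ≤ ‖mk half n g‖ := by
  refine le_of_forall_pos_le_add fun η hη => ?_
  obtain ⟨g', hg', hlt⟩ := exists_norm_lt half n g (lt_add_of_pos_right _ hη)
  have h := taylor_mulLeft_halfZero hg'
  rw [map_sub] at h
  rw [mk_eq_of_taylor_sub h]
  refine (norm_mk_le _ _ _).trans ((norm_mulLeft_le _ _ _).trans ?_)
  exact (mul_le_of_le_one_left (norm_nonneg _) norm_halfZero_le).trans hlt.le

theorem toFun_eq_zero_of_taylor {z : verticalStrip 0 1} {n : ℕ} {f : Calderon ι₀ ι₁}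
    (h : taylor z (n + 1) f = 0) : f.toFun z = 0 := by
  have := congrFun h 0
  change ((Nat.factorial 0 : ℂ))⁻¹ • iteratedDeriv 0 f.toFun z = 0 at this
  simpa using this

/-- A representative of norm below twice the infimum still vanishes at `1/2` and can be divided by
`halfZero` at cost 4; hence `8 = 2 * 4`. -/
theorem exists_mulLeft_halfZero (n : ℕ) (f : Calderon ι₀ ι₁) (hf : f.toFun (1 / 2) = 0) :
    ∃ g : Calderon ι₀ ι₁,
      ‖mk half (n + 1) (f - mulLeft halfZero differentiableOn_halfZero g)‖ = 0 ∧
      ‖mk half n g‖ ≤ 8 * ‖mk half (n + 1) f‖ := by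
  rcases eq_or_ne (mk half (n + 1) f) 0 with h0 | h0
  · exact ⟨0, by simp [h0], by simp⟩
  · obtain ⟨f', hf', hlt⟩ := exists_norm_lt half (n + 1) f
      (C := 2 * ‖mk half (n + 1) f‖) (by linarith [norm_pos_iff.2 h0])
    have h1 : (f - f').toFun half = 0 := toFun_eq_zero_of_taylor hf'
    have h2 : f'.toFun (1 / 2) = 0 := by
      have h3 : f = (f - f') + f' := by abel
      rw [h3, toFun_add, Pi.add_apply] at hf
      rw [half_coe] at h1
      rwa [h1, zero_add] at hf
    obtain ⟨g, rfl, hgn⟩ := exists_mulLeft_halfZero_eq f' h2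
    refine ⟨g, ?_, (norm_mk_le _ _ _).trans (hgn.trans (by linarith))⟩
    rw [mk_eq_zero_iff.2 hf', norm_zero]

end RochbergSpace

/-! ### The couple `(ℓ_∞, ℓ₁)`: the values at `1/2` form `ℓ₂`, isometrically. -/

/-- The Calderón space of the couple `(ℓ_∞, ℓ₁)`. -/
abbrev EllCalderon : Type := Calderon (ContinuousLinearMap.id ℂ (ell ∞)) ellOneIncl

namespace EllCalderon

open Calderon

theorem ellOneIncl_apply (x : ell 1) (i : ℕ) : ellOneIncl x i = x i := rfl

theorem sum_norm_le (x : ell 1) (s : Finset ℕ) : ∑ i ∈ s, ‖x i‖ ≤ ‖x‖ := by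
  simpa using lp.sum_rpow_le_norm_rpow (by simp) x s

theorem norm_exp_sub_one_mul (z : ℂ) (l : ℝ) :
    ‖Complex.exp ((z - 1) * l)‖ = Real.exp ((z.re - 1) * l) := by
  rw [Complex.norm_exp]
  simp

/-- The three lines theorem for the pairing of a function of the Calderón space with weights. -/
theorem norm_pairing_le (f : EllCalderon) (s : Finset ℕ) (u : ℕ → ℂ) (l : ℕ → ℝ)
    (hu : ∀ i ∈ s, ‖u i‖ ≤ 1) (hl : ∑ i ∈ s, Real.exp (-l i) ≤ 1) {z : ℂ}
    (hz : z ∈ verticalClosedStrip 0 1) :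
    ‖∑ i ∈ s, u i * Complex.exp ((z - 1) * l i) * f.toFun z i‖ ≤ ‖f‖ := by
  have hcoord : ∀ i, DifferentiableOn ℂ (fun z => f.toFun z i) (verticalStrip 0 1) := fun i =>
    (lp.evalCLM ℂ (fun _ : ℕ => ℂ) ∞ i).differentiable.comp_differentiableOn f.differentiableOn
  have hcoord' : ∀ i, ContinuousOn (fun z => f.toFun z i) (verticalClosedStrip 0 1) := fun i =>
    (lp.evalCLM ℂ (fun _ : ℕ => ℂ) ∞ i).continuous.comp_continuousOn f.continuousOn_toFun
  have hterm : ∀ w : ℂ, ∀ i ∈ s, ‖u i * Complex.exp ((w - 1) * l i) * f.toFun w i‖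
      ≤ Real.exp ((w.re - 1) * l i) * ‖f.toFun w i‖ := by
    intro w i hi
    rw [norm_mul, norm_mul, norm_exp_sub_one_mul]
    exact mul_le_mul_of_nonneg_right
      (mul_le_of_le_one_left (Real.exp_nonneg _) (hu i hi)) (norm_nonneg _)
  -- On the left line the weights have moduli `exp (-l i)` with sum at most one, to be paired with
  -- `ℓ_∞`; on the right line their moduli are at most one, to be paired with `ℓ₁`.
  refine PhragmenLindelof.vertical_strip (a := 0) (b := 1)
    (f := fun z => ∑ i ∈ s, u i * Complex.exp ((z - 1) * l i) * f.toFun z i)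
    ⟨?_, ?_⟩ ?_ ?_ ?_ hz.1 hz.2
  · refine DifferentiableOn.fun_sum fun i _ => DifferentiableOn.mul ?_ (hcoord i)
    fun_prop
  · rw [← verticalStrip, closure_strip]
    refine continuousOn_finsetSum _ fun i _ => ContinuousOn.mul ?_ (hcoord' i)
    fun_prop
  · refine ⟨0, by positivity, 0, ?_⟩
    refine Asymptotics.IsBigO.of_bound (∑ i ∈ s, Real.exp |l i| * ‖f.1.1‖) ?_
    refine Filter.Eventually.filter_mono inf_le_right ?_
    refine Filter.eventually_principal.2 fun w hw => ?_
    simp only [zero_mul, Real.exp_zero, norm_one, mul_one]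
    refine (norm_sum_le _ _).trans (Finset.sum_le_sum fun i hi => (hterm w i hi).trans ?_)
    refine mul_le_mul (Real.exp_le_exp.2 ?_) ?_ (norm_nonneg _) (Real.exp_nonneg _)
    · refine (le_abs_self _).trans ?_
      rw [abs_mul]
      refine mul_le_of_le_one_left (abs_nonneg _) ?_
      rw [abs_le]
      constructor <;> linarith [hw.1, hw.2]
    · rw [toFun_apply f (strip_subset hw)]
      exact (lp.norm_apply_le_norm ENNReal.top_ne_zero _ i).trans (f.1.1.norm_coe_le_norm _)
  · intro w hw
    have h1 : w = w.im * Complex.I := by apply Complex.ext <;> simp [hw]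
    refine (norm_sum_le _ _).trans ?_
    calc _ ≤ ∑ i ∈ s, Real.exp (-l i) * ‖f‖ := by
          refine Finset.sum_le_sum fun i hi => (hterm w i hi).trans ?_
          rw [hw, zero_sub, neg_one_mul]
          refine mul_le_mul_of_nonneg_left ?_ (Real.exp_nonneg _)
          rw [h1, toFun_left]
          exact (lp.norm_apply_le_norm ENNReal.top_ne_zero _ i).trans (f.norm_left_le _)
      _ ≤ ‖f‖ := by
          rw [← Finset.sum_mul]
          exact mul_le_of_le_one_left (norm_nonneg _) hl
  · intro w hw
    have h1 : w = 1 + w.im * Complex.I := by apply Complex.ext <;> simp [hw]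
    refine (norm_sum_le _ _).trans ?_
    calc _ ≤ ∑ i ∈ s, ‖(boundary f).2 w.im i‖ := by
          refine Finset.sum_le_sum fun i hi => (hterm w i hi).trans_eq ?_
          rw [hw, sub_self, zero_mul, Real.exp_zero, one_mul]
          conv_lhs => rw [h1, toFun_right, ellOneIncl_apply]
      _ ≤ ‖f‖ := (sum_norm_le _ s).trans (f.norm_right_le _)

/-- Values at `1/2` are square summable. -/
theorem sum_sq_norm_half_le (f : EllCalderon) (s : Finset ℕ) :
    ∑ i ∈ s, ‖f.toFun (1 / 2) i‖ ^ 2 ≤ ‖f‖ ^ 2 := by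
  set a : ℕ → ℂ := fun i => f.toFun (1 / 2) i with ha
  set S : ℝ := ∑ i ∈ s, ‖a i‖ ^ 2 with hS
  have hS0 : 0 ≤ S := Finset.sum_nonneg fun i _ => sq_nonneg _
  rcases hS0.eq_or_lt with h0 | hpos
  · change S ≤ _
    rw [← h0]; positivity
  set s' : Finset ℕ := s.filter fun i => a i ≠ 0 with hs'
  have hS' : S = ∑ i ∈ s', ‖a i‖ ^ 2 := by
    rw [hS, hs', Finset.sum_filter]
    refine Finset.sum_congr rfl fun i _ => ?_
    split_ifs with h
    · rfl
    · simp [not_not.1 h]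
  have hne : ∀ i ∈ s', 0 < ‖a i‖ := fun i hi => norm_pos_iff.2 (Finset.mem_filter.1 hi).2
  have hmem : (1 / 2 : ℂ) ∈ verticalClosedStrip 0 1 := strip_subset half.2
  -- The choice `exp (-l i) = ‖a i‖ ^ 2 / S` has total mass one. At `1/2` the weights are `‖a i‖ /
  -- √S`, so the pairing equals `√S`. The logarithms are the reason for discarding zero entries.
  have key := norm_pairing_le f s' (fun i => (starRingEnd ℂ) (a i) / ‖a i‖)
    (fun i => Real.log S - 2 * Real.log ‖a i‖) (fun i hi => by
      rw [norm_div, RCLike.norm_conj, Complex.norm_real, norm_norm]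
      exact div_self_le_one _) (le_of_eq ?_) hmem
  · have hval : ∀ i ∈ s', (starRingEnd ℂ) (a i) / ‖a i‖ * Complex.exp ((1 / 2 - 1) *
        ((Real.log S - 2 * Real.log ‖a i‖ : ℝ) : ℂ)) * f.toFun (1 / 2) i
        = ((‖a i‖ ^ 2 / √S : ℝ) : ℂ) := by
      intro i hi
      have hn := hne i hi
      have h1 : Complex.exp ((1 / 2 - 1) * ((Real.log S - 2 * Real.log ‖a i‖ : ℝ) : ℂ))
          = ((‖a i‖ / √S : ℝ) : ℂ) := by
        have : (1 / 2 - 1 : ℂ) * ((Real.log S - 2 * Real.log ‖a i‖ : ℝ) : ℂ)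
            = ((Real.log ‖a i‖ - Real.log (√S) : ℝ) : ℂ) := by
          rw [Real.log_sqrt hS0]
          push_cast
          ring
        rw [this, ← Complex.ofReal_exp, Real.exp_sub, Real.exp_log hn,
          Real.exp_log (Real.sqrt_pos.2 hpos)]
      have hnc : (‖a i‖ : ℂ) ≠ 0 := by exact_mod_cast hn.ne'
      rw [h1]
      change _ * _ * a i = _
      have h2 : (starRingEnd ℂ) (a i) * a i = (‖a i‖ : ℂ) ^ 2 := Complex.conj_mul' (a i)
      push_cast
      field_simp
      rw [h2]
    rw [Finset.sum_congr rfl hval, ← Complex.ofReal_sum, ← Finset.sum_div, ← hS',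
      Real.div_sqrt, Complex.norm_real, Real.norm_of_nonneg (Real.sqrt_nonneg _)] at key
    calc S = √S ^ 2 := (Real.sq_sqrt hS0).symm
      _ ≤ _ := pow_le_pow_left₀ (Real.sqrt_nonneg _) key 2
  · have : ∀ i ∈ s', Real.exp (-(Real.log S - 2 * Real.log ‖a i‖)) = ‖a i‖ ^ 2 / S := by
      intro i hi
      rw [show -(Real.log S - 2 * Real.log ‖a i‖) = Real.log (‖a i‖ ^ 2) - Real.log S by
        rw [Real.log_pow]; push_cast; ring, Real.exp_sub, Real.exp_log hpos,
        Real.exp_log (by have := hne i hi; positivity)]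
    rw [Finset.sum_congr rfl this, ← Finset.sum_div, ← hS', div_self hpos.ne']

theorem memℓp_half (f : EllCalderon) : Memℓp (fun i => f.toFun (1 / 2) i) 2 :=
  memℓp_gen' (C := ‖f‖ ^ 2) fun s => by simpa using sum_sq_norm_half_le f s

/-- Evaluation at `1/2`, as a map into `ℓ₂`. -/
def evalHalf : EllCalderon →ₗ[ℂ] ell 2 where
  toFun f := ⟨fun i => f.toFun (1 / 2) i, memℓp_half f⟩
  map_add' f g := by
    ext i
    change (f + g).toFun (1 / 2) i = f.toFun (1 / 2) i + g.toFun (1 / 2) i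
    rw [toFun_add]
    rfl
  map_smul' c f := by
    ext i
    change (c • f).toFun (1 / 2) i = c • f.toFun (1 / 2) i
    rw [toFun_smul]
    rfl

theorem evalHalf_apply (f : EllCalderon) (i : ℕ) : evalHalf f i = f.toFun (1 / 2) i := rfl

theorem norm_evalHalf_le (f : EllCalderon) : ‖evalHalf f‖ ≤ ‖f‖ :=
  lp.norm_le_of_forall_sum_le (by simp) (norm_nonneg _) fun s => by
    simpa [evalHalf_apply] using sum_sq_norm_half_le f s

theorem sum_single_apply (p : ℝ≥0∞) (s : Finset ℕ) (c : ℕ → ℂ) (j : ℕ) :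
    (∑ i ∈ s, lp.single (E := fun _ : ℕ => ℂ) p i (c i)) j = if j ∈ s then c j else 0 := by
  rw [lp.coeFn_sum, Finset.sum_apply]
  simp only [lp.single_apply, Pi.single_apply]
  simp

/-- Finitely supported sequences in `ℓ₂` are values at `1/2` of functions of the same norm. -/
theorem exists_evalHalf_eq_of_finite (a : ell 2) (s : Finset ℕ) (hs : ∀ i, i ∉ s → a i = 0) :
    ∃ f : EllCalderon, evalHalf f = a ∧ ‖f‖ ≤ ‖a‖ := by
  rcases eq_or_ne a 0 with rfl | ha
  · exact ⟨0, map_zero _, by simp⟩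
  set ν : ℝ := ‖a‖ with hν
  have hν0 : 0 < ν := norm_pos_iff.2 ha
  set l : ℕ → ℝ := fun i => Real.log (‖a i‖ / ν) with hl
  -- The extremal function `a i * (‖a i‖ / ν) ^ (2 z - 1)`: for nonzero entries its modulus is `ν`
  -- on the left line and `‖a i‖ ^ 2 / ν` on the right one, and its value at `1/2` is `a i`. Where
  -- `a i = 0` the default value of the logarithm is harmless, as the factor `a i` remains.
  set c : ℂ → ℕ → ℂ := fun z i => a i * Complex.exp ((2 * z - 1) * l i) with hc
  have hcn : ∀ z i, ‖c z i‖ = ‖a i‖ * Real.exp ((2 * z.re - 1) * l i) := by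
    intro z i
    rw [hc]
    simp only
    rw [norm_mul, Complex.norm_exp]
    simp
  have hexp : ∀ i, a i ≠ 0 → Real.exp (l i) = ‖a i‖ / ν := fun i hi =>
    Real.exp_log (div_pos (norm_pos_iff.2 hi) hν0)
  have hc0 : ∀ (t : ℝ) i, ‖c (t * Complex.I) i‖ ≤ ν := by
    intro t i
    rw [hcn]
    by_cases hi : a i = 0
    · simp [hi, hν0.le]
    · have hp := norm_pos_iff.2 hi
      simp only [Complex.mul_re, Complex.ofReal_re, Complex.I_re, mul_zero, Complex.ofReal_im,
        Complex.I_im, mul_one, sub_self, zero_sub, neg_one_mul, Real.exp_neg, hexp i hi]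
      rw [inv_div, mul_div_cancel₀ _ hp.ne']
  have hc1 : ∀ (t : ℝ) i, ‖c (1 + t * Complex.I) i‖ = ‖a i‖ ^ 2 / ν := by
    intro t i
    rw [hcn]
    by_cases hi : a i = 0
    · simp [hi]
    · have : 2 * (1 + t * Complex.I : ℂ).re - 1 = 1 := by simp; norm_num
      rw [this, one_mul, hexp i hi]
      ring
  have hsum : ∑ i ∈ s, ‖a i‖ ^ 2 / ν ≤ ν := by
    rw [← Finset.sum_div, div_le_iff₀ hν0, ← sq]
    simpa using lp.sum_rpow_le_norm_rpow (by simp) a s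
  have hcd : ∀ i, Differentiable ℂ fun z => c z i := fun i => by
    simp only [hc]; fun_prop
  let F : ℂ → ell ∞ := fun z => ∑ i ∈ s, lp.single (E := fun _ : ℕ => ℂ) ∞ i (c z i)
  have hFd : Differentiable ℂ F := Differentiable.fun_sum fun i _ =>
    (lp.singleContinuousLinearMap ℂ (fun _ : ℕ => ℂ) ∞ i).differentiable.comp (hcd i)
  have hFb : ∀ z ∈ verticalClosedStrip 0 1, ‖F z‖ ≤ ∑ i ∈ s, ‖a i‖ * Real.exp |l i| := by
    intro z hz
    refine (norm_sum_le _ _).trans (Finset.sum_le_sum fun i _ => ?_)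
    rw [lp.norm_single (by simp), hcn]
    refine mul_le_mul_of_nonneg_left (Real.exp_le_exp.2 ?_) (norm_nonneg _)
    refine (le_abs_self _).trans ?_
    rw [abs_mul]
    refine mul_le_of_le_one_left (abs_nonneg _) ?_
    have h1 : 0 ≤ z.re := hz.1
    have h2 : z.re ≤ 1 := hz.2
    rw [abs_le]
    constructor <;> linarith
  have hG : ∀ t : ℝ, ‖F (t * Complex.I)‖ ≤ ν := fun t =>
    lp.norm_le_of_forall_le hν0.le fun j => by
      change ‖(∑ i ∈ s, lp.single (E := fun _ : ℕ => ℂ) ∞ i (c (t * Complex.I) i)) j‖ ≤ ν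
      rw [sum_single_apply]
      split_ifs
      · exact hc0 t j
      · simpa using hν0.le
  have hH : ∀ t : ℝ, ‖(∑ i ∈ s, lp.single (E := fun _ : ℕ => ℂ) 1 i (c (1 + t * Complex.I) i))‖
      ≤ ν := fun t => by
    refine (norm_sum_le _ _).trans (le_trans (Finset.sum_le_sum fun i _ => ?_) hsum)
    rw [lp.norm_single (by simp), hc1]
  let g₀ : ℝ →ᵇ ell ∞ := BoundedContinuousFunction.ofNormedAddCommGroup
    (fun t : ℝ => F (t * Complex.I)) (hFd.continuous.comp (by fun_prop)) ν hG
  let g₁ : ℝ →ᵇ ell 1 := BoundedContinuousFunction.ofNormedAddCommGroup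
    (fun t : ℝ => ∑ i ∈ s, lp.single (E := fun _ : ℕ => ℂ) 1 i (c (1 + t * Complex.I) i))
    (continuous_finsetSum _ fun i _ =>
      (lp.singleContinuousLinearMap ℂ (fun _ : ℕ => ℂ) 1 i).continuous.comp
        ((hcd i).continuous.comp (by fun_prop))) ν hH
  refine ⟨ofFun F hFd.differentiableOn hFd.continuous.continuousOn _ hFb g₀ g₁ (fun t => rfl)
    (fun t => ?_), ?_, norm_le_of_boundary hν0.le hG hH⟩
  · ext j
    rw [ellOneIncl_apply]
    exact (sum_single_apply _ _ _ _).trans (sum_single_apply _ _ _ _).symm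
  · ext j
    rw [evalHalf_apply]
    refine (congrArg (fun v : ell ∞ => v j) (toFun_ofFun (strip_subset half.2))).trans ?_
    refine (sum_single_apply _ _ _ _).trans ?_
    split_ifs with h
    · simp [hc, half_coe]
    · exact (hs j h).symm

/-- The finitely supported elements of `ℓ₂`. -/
def finiteSupport : AddSubgroup (ell 2) where
  carrier := {a | ∃ s : Finset ℕ, ∀ i, i ∉ s → a i = 0}
  zero_mem' := ⟨∅, fun i _ => rfl⟩
  add_mem' := by
    rintro a b ⟨s, hs⟩ ⟨t, ht⟩
    refine ⟨s ∪ t, fun i hi => ?_⟩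
    rw [Finset.mem_union, not_or] at hi
    rw [lp.coeFn_add, Pi.add_apply, hs i hi.1, ht i hi.2, add_zero]
  neg_mem' := by
    rintro a ⟨s, hs⟩
    exact ⟨s, fun i hi => by rw [lp.coeFn_neg, Pi.neg_apply, hs i hi, neg_zero]⟩

theorem mem_closure_finiteSupport (a : ell 2) : a ∈ finiteSupport.topologicalClosure := by
  have h := lp.hasSum_single (by simp : (2 : ℝ≥0∞) ≠ ⊤) a
  refine mem_closure_of_tendsto h (Filter.Eventually.of_forall fun s => ⟨s, fun i hi => ?_⟩)
  rw [sum_single_apply 2 s (fun i => a i), if_neg hi]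

/-- Every element of `ℓ₂` is the value at `1/2` of functions of almost the same norm. -/
theorem exists_evalHalf_eq (a : ell 2) {η : ℝ} (hη : 0 < η) :
    ∃ f : EllCalderon, evalHalf f = a ∧ ‖f‖ ≤ (1 + η) * ‖a‖ := by
  let φ : NormedAddGroupHom EllCalderon (ell 2) :=
    evalHalf.toAddMonoidHom.mkNormedAddGroupHom 1 fun f => by
      rw [one_mul]; exact norm_evalHalf_le f
  have hsurj : φ.SurjectiveOnWith finiteSupport 1 := by
    rintro b ⟨s, hs⟩
    obtain ⟨f, hf, hn⟩ := exists_evalHalf_eq_of_finite b s hs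
    exact ⟨f, hf, by rwa [one_mul]⟩
  -- Approximation by finitely supported sequences, lifted one after the other and summed as a
  -- series, at the price of `1 + η`.
  exact controlled_closure_of_complete one_pos hη hsurj a (mem_closure_finiteSupport a)

/-! ### Lower bounds: signed sums of unit vectors. -/

open RochbergSpace

/-- The constant function with value the `i`-th unit vector. -/
def unitVec (i : ℕ) : EllCalderon :=
  ofFun (fun _ => lp.single (E := fun _ : ℕ => ℂ) ∞ i 1) (differentiableOn_const _)
    continuousOn_const _ (fun _ _ => le_rfl)
    (BoundedContinuousFunction.const ℝ (lp.single (E := fun _ : ℕ => ℂ) ∞ i 1))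
    (BoundedContinuousFunction.const ℝ (lp.single (E := fun _ : ℕ => ℂ) 1 i 1))
    (fun _ => rfl) (fun _ => rfl)

theorem norm_unitVec_le (i : ℕ) : ‖unitVec i‖ ≤ 1 :=
  norm_le_of_boundary zero_le_one
    (fun _ => by
      change ‖lp.single (E := fun _ : ℕ => ℂ) ∞ i 1‖ ≤ 1
      rw [lp.norm_single (by simp), norm_one])
    (fun _ => by
      change ‖lp.single (E := fun _ : ℕ => ℂ) 1 i 1‖ ≤ 1
      rw [lp.norm_single (by simp), norm_one])

/-- Evaluation at a point. -/
def evalAt (z : ℂ) : EllCalderon →ₗ[ℂ] ell ∞ where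
  toFun f := f.toFun z
  map_add' f g := by rw [toFun_add]; rfl
  map_smul' c f := by rw [toFun_smul]; rfl

theorem toFun_sum_unitVec {N : ℕ} (ε : Fin N → ℤˣ) {z : ℂ} (hz : z ∈ verticalClosedStrip 0 1)
    (j : Fin N) : (∑ i, ε i • unitVec i).toFun z j = ((ε j : ℤ) : ℂ) := by
  have h1 : (∑ i, ε i • unitVec i).toFun z
      = ∑ i, ((ε i : ℤ) : ℂ) • lp.single (E := fun _ : ℕ => ℂ) ∞ (i : ℕ) (1 : ℂ) := by
    change evalAt z (∑ i, ε i • unitVec i) = _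
    rw [map_sum]
    refine Finset.sum_congr rfl fun i _ => ?_
    have h2 : evalAt z (unitVec i) = lp.single (E := fun _ : ℕ => ℂ) ∞ (i : ℕ) 1 := toFun_ofFun hz
    rw [← h2, ← map_smul]
    congr 1
    rcases Int.units_eq_one_or (ε i) with h | h <;> simp [h]
  rw [h1, lp.coeFn_sum, Finset.sum_apply, Finset.sum_eq_single j]
  · rw [lp.coeFn_smul, Pi.smul_apply, lp.single_apply_self, smul_eq_mul, mul_one]
  · intro i _ hij
    rw [lp.coeFn_smul, Pi.smul_apply, lp.single_apply_ne _ _ _ (fun h => hij (Fin.ext h).symm),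
      smul_zero]
  · simp

theorem iteratedDeriv_exp_mul (l : ℂ) (n : ℕ) (z : ℂ) :
    iteratedDeriv n (fun z => Complex.exp (l * z)) z = l ^ n * Complex.exp (l * z) := by
  rw [iteratedDeriv_cexp_const_mul]

/-- Lower estimate for the norm of sums of unit vectors in Rochberg spaces. -/
theorem norm_mk_sum_unitVec_ge (m : ℕ) {N : ℕ} (hN : 0 < N) (ε : Fin N → ℤˣ) :
    √N * Real.log N ^ m ≤ m.factorial * 4 ^ m * ‖mk half (m + 1) (∑ i, ε i • unitVec i)‖ := by
  set G : EllCalderon := ∑ i, ε i • unitVec i with hG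
  set l : ℝ := Real.log N with hl
  have hNpos : (0 : ℝ) < N := by exact_mod_cast hN
  have hexpl : Real.exp l = N := Real.exp_log hNpos
  have hl0 : 0 ≤ l := Real.log_natCast_nonneg N
  -- The quotient norm is an infimum over all `f` with the same `m + 1` coefficients as `G`.
  suffices h : ∀ f : EllCalderon, taylor half (m + 1) (G - f) = 0 →
      √N * l ^ m ≤ m.factorial * 4 ^ m * ‖f‖ by
    refine le_of_forall_pos_le_add fun η hη => ?_
    have hK : (0 : ℝ) < m.factorial * 4 ^ m := by positivity
    obtain ⟨f, hf, hlt⟩ := exists_norm_lt half (m + 1) G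
      (lt_add_of_pos_right _ (div_pos hη hK))
    refine (h f hf).trans ((mul_le_mul_of_nonneg_left hlt.le hK.le).trans_eq ?_)
    rw [mul_add, mul_div_cancel₀ _ hK.ne']
  intro f hf
  let u : ℕ → ℂ := fun i => if h : i < N then ((ε ⟨i, h⟩ : ℤ) : ℂ) else 0
  have huu : ∀ i ∈ Finset.range N, u i * u i = 1 := by
    intro i hi
    simp only [u, dif_pos (Finset.mem_range.1 hi)]
    rcases Int.units_eq_one_or (ε ⟨i, Finset.mem_range.1 hi⟩) with h | h <;> simp [h]
  have hun : ∀ i ∈ Finset.range N, ‖u i‖ ≤ 1 := by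
    intro i hi
    simp only [u, dif_pos (Finset.mem_range.1 hi)]
    rcases Int.units_eq_one_or (ε ⟨i, Finset.mem_range.1 hi⟩) with h | h <;> simp [h]
  have huG : ∀ i ∈ Finset.range N, ∀ z ∈ verticalClosedStrip 0 1, G.toFun z i = u i := by
    intro i hi z hz
    have hi' := Finset.mem_range.1 hi
    simp only [u, dif_pos hi']
    exact toFun_sum_unitVec ε hz ⟨i, hi'⟩
  -- Pairing with the signs and the common weight `l = log N`, for which `N * exp (-l) = 1`. It is
  -- bounded by `‖f‖` on `f`, and equals `N * exp ((z - 1) * l) = exp (l * z)` on `G` because the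
  -- signs square to one.
  let F : EllCalderon → ℂ → ℂ := fun h z =>
    ∑ i ∈ Finset.range N, u i * Complex.exp ((z - 1) * l) * h.toFun z i
  have hFle : ∀ z ∈ verticalClosedStrip 0 1, ‖F f z‖ ≤ ‖f‖ := fun z hz =>
    norm_pairing_le f (Finset.range N) u (fun _ => l) hun (by
      rw [Finset.sum_const, Finset.card_range, nsmul_eq_mul, Real.exp_neg, hexpl,
        mul_inv_cancel₀ hNpos.ne']) hz
  let Λ : ell ∞ →L[ℂ] ℂ := ∑ i ∈ Finset.range N, u i • lp.evalCLM ℂ (fun _ : ℕ => ℂ) ∞ i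
  have hFΛ : ∀ h z, F h z = Complex.exp ((z - 1) * l) * Λ (h.toFun z) := by
    intro h z
    have : Λ (h.toFun z) = ∑ i ∈ Finset.range N, u i * h.toFun z i := by
      simp only [Λ, _root_.sum_apply, _root_.smul_apply, smul_eq_mul]
      rfl
    rw [this, Finset.mul_sum]
    exact Finset.sum_congr rfl fun i _ => by ring
  have hFd : ∀ h, DifferentiableOn ℂ (F h) (verticalStrip 0 1) := by
    intro h
    have : F h = fun z => Complex.exp ((z - 1) * l) * Λ (h.toFun z) := funext (hFΛ h)
    rw [this]
    exact DifferentiableOn.mul (by fun_prop)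
      (Λ.differentiable.comp_differentiableOn h.differentiableOn)
  have hFG : F G =ᶠ[nhds (half : ℂ)] fun z => Complex.exp (l * z) := by
    filter_upwards [strip_mem_nhds half.2] with z hz
    have : ∀ i ∈ Finset.range N, u i * Complex.exp ((z - 1) * l) * G.toFun z i
        = Complex.exp ((z - 1) * l) := by
      intro i hi
      rw [huG i hi z (strip_subset hz), mul_right_comm, huu i hi, one_mul]
    change ∑ i ∈ Finset.range N, u i * Complex.exp ((z - 1) * l) * G.toFun z i = _
    rw [Finset.sum_congr rfl this, Finset.sum_const, Finset.card_range, nsmul_eq_mul]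
    have hNl : (N : ℂ) = Complex.exp l := by
      rw [← Complex.ofReal_exp, hexpl]; simp
    rw [hNl, ← Complex.exp_add]
    congr 1
    ring
  have hFan : ∀ h, AnalyticAt ℂ (F h) half := fun h =>
    (hFd h).analyticAt (strip_mem_nhds half.2)
  -- `F` depends on `h` through one continuous functional and an analytic factor, so the zero of
  -- order `m + 1` of `G - f` is inherited.
  have hzero : iteratedDeriv m (F (G - f)) half = 0 := by
    refine (natCast_le_analyticOrderAt_iff_iteratedDeriv_eq_zero (hFan _) (n := m + 1)).1 ?_ m
      (Nat.lt_succ_self m)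
    rw [taylor_eq_zero_iff, natCast_le_analyticOrderAt ((G - f).analyticAt_toFun half.2)] at hf
    rw [natCast_le_analyticOrderAt (hFan _)]
    obtain ⟨g, hg, hgeq⟩ := hf
    refine ⟨fun z => Complex.exp ((z - 1) * l) * Λ (g z), AnalyticAt.mul ?_ ?_, ?_⟩
    · exact (Differentiable.analyticAt (by fun_prop) _)
    · exact (Λ.analyticAt _).comp hg
    · filter_upwards [hgeq] with z hz
      rw [hFΛ, hz, map_smul, smul_eq_mul, smul_eq_mul]
      ring
  have hsub : F (G - f) = F G - F f := by
    funext z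
    have h1 : (G - f).toFun z = G.toFun z - f.toFun z := map_sub (evalAt z) G f
    rw [Pi.sub_apply, hFΛ, hFΛ, hFΛ, h1, map_sub, mul_sub]
  rw [hsub, iteratedDeriv_sub (hFan G).contDiffAt (hFan f).contDiffAt, sub_eq_zero,
    hFG.iteratedDeriv_eq, iteratedDeriv_exp_mul] at hzero
  -- The radius `1/4` keeps the closed disc in the open strip and is the source of `4 ^ m` in the
  -- Cauchy estimate.
  have hball : Metric.closedBall (half : ℂ) (1 / 4) ⊆ verticalStrip 0 1 := by
    intro z hz
    have h1 := (Complex.abs_re_le_norm (z - half)).trans (mem_closedBall_iff_norm.1 hz)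
    rw [abs_le, half_coe] at h1
    simp at h1
    constructor <;> linarith
  have hcauchy := Complex.norm_iteratedDeriv_le_of_forall_mem_sphere_norm_le (c := (half : ℂ))
    (R := 1 / 4) (C := ‖f‖) (f := F f) m (by norm_num)
    (((hFd f).mono hball).diffContOnCl_ball subset_rfl)
    (fun w hw => hFle w (strip_subset (hball (Metric.sphere_subset_closedBall hw))))
  rw [← hzero] at hcauchy
  have hval : ‖(l : ℂ) ^ m * Complex.exp (l * half)‖ = √N * l ^ m := by
    rw [norm_mul, norm_pow, Complex.norm_real, Real.norm_of_nonneg hl0, Complex.norm_exp, half_coe,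
      mul_comm]
    congr 1
    rw [← hexpl, ← Real.exp_half]
    congr 1
    simp
    ring
  rw [hval] at hcauchy
  refine hcauchy.trans_eq ?_
  rw [one_div, inv_pow, div_inv_eq_mul]
  ring

/-! ### Comparison of the two growth rates. -/

/-- The type 2 constants of the Rochberg spaces grow at most like powers of the logarithm. -/
theorem exists_hasTypeTwo_mkSeminorm (m : ℕ) :
    ∃ D : ℝ, 0 ≤ D ∧ ∀ k : ℕ, HasTypeTwo
      (mkSeminorm (ContinuousLinearMap.id ℂ (ell ∞)) ellOneIncl half m)
      (Fin (2 ^ k)) (D * (k + 1) ^ (m - 1)) := by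
  refine exists_hasTypeTwo
    (fun m => mkSeminorm (ContinuousLinearMap.id ℂ (ell ∞)) ellOneIncl half m) evalHalf
    (mulLeft halfZero differentiableOn_halfZero) (C := 8) (by norm_num) ?_ ?_ ?_ ?_ ?_ m
  · intro f
    change ‖mk half 0 f‖ = 0
    rw [norm_eq_zero, mk_eq_zero_iff]
    exact Subsingleton.elim _ _
  · intro m f
    refine le_of_forall_pos_le_add fun η hη => ?_
    obtain ⟨g, hg, hlt⟩ := exists_norm_lt half (m + 1) f (lt_add_of_pos_right _ hη)
    have h1 : evalHalf (f - g) = 0 := by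
      ext i
      rw [evalHalf_apply, ← half_coe, toFun_eq_zero_of_taylor hg]
      rfl
    rw [map_sub, sub_eq_zero] at h1
    rw [h1]
    exact (norm_evalHalf_le g).trans hlt.le
  · intro m y η hη
    obtain ⟨h, hh, hn⟩ := exists_evalHalf_eq (evalHalf y) hη
    exact ⟨h, hh, (norm_mk_le _ _ _).trans hn⟩
  · intro m f hf
    refine exists_mulLeft_halfZero m f ?_
    ext i
    exact congrArg (fun v : ell 2 => v i) hf
  · intro m g
    refine (norm_mk_mulLeft_halfZero_le m g).trans ?_
    exact le_mul_of_one_le_left (norm_nonneg _) (by norm_num)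

/-- Carries the type 2 inequality from representatives in the Calderón space to elements of the
Rochberg space. -/
theorem sum_signs_mk_le {m N : ℕ} {A K : ℝ} (x : Fin N → Z m)
    (h : HasTypeTwo (mkSeminorm (ContinuousLinearMap.id ℂ (ell ∞)) ellOneIncl half m) (Fin N) A)
    (hx : ∀ i, ‖x i‖ ≤ K) :
    ∑ ε : Fin N → ℤˣ, ‖∑ i, ε i • x i‖ ^ 2 ≤ 2 ^ N * N * (A * K) ^ 2 := by
  choose y hy using fun i => mk_surjective half m (x i)
  have key := h y
  have h1 : ∀ ε : Fin N → ℤˣ, mk half m (∑ i, ε i • y i) = ∑ i, ε i • x i := by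
    intro ε
    rw [map_sum]
    exact Finset.sum_congr rfl fun i _ => by rw [map_units_smul, hy]
  simp only [mkSeminorm_apply, h1, hy, Fintype.card_fin] at key
  refine key.trans ?_
  calc _ ≤ A ^ 2 * (2 ^ N * ∑ i : Fin N, K ^ 2) := by
        gcongr with i
        exact hx i
    _ = _ := by
        rw [Finset.sum_const, Finset.card_univ, Fintype.card_fin, nsmul_eq_mul]
        ring

/-- A bounded operator with a bounded left inverse forces lower bounds for type 2 constants. -/
theorem log_pow_le_of_leftInverse {a m a' b' N : ℕ} (hN : 0 < N) {A : ℝ} (hA : 0 ≤ A)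
    (h₁ : HasTypeTwo (mkSeminorm (ContinuousLinearMap.id ℂ (ell ∞)) ellOneIncl half a') (Fin N) A)
    (h₂ : HasTypeTwo (mkSeminorm (ContinuousLinearMap.id ℂ (ell ∞)) ellOneIncl half b') (Fin N) A)
    (S : (Z a × Z (m + 1)) →L[ℂ] (Z a' × Z b')) (R : (Z a' × Z b') →L[ℂ] (Z a × Z (m + 1)))
    (hRS : ∀ x, R (S x) = x) :
    Real.log N ^ m ≤ 2 * (m.factorial * 4 ^ m) * ‖R‖ * ‖S‖ * A := by
  set B : ℝ := m.factorial * 4 ^ m with hB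
  have hB0 : 0 < B := by positivity
  let w : Fin N → Z (m + 1) := fun i => mk half (m + 1) (unitVec i)
  let v : Fin N → Z a' × Z b' := fun i => S (0, w i)
  have hw : ∀ i, ‖w i‖ ≤ 1 := fun i => (norm_mk_le _ _ _).trans (norm_unitVec_le _)
  have hv : ∀ i, ‖v i‖ ≤ ‖S‖ := fun i => by
    refine (S.le_opNorm _).trans (mul_le_of_le_one_right (norm_nonneg _) ?_)
    rw [Prod.norm_def]
    exact max_le (by simp) (hw i)
  have h1 := sum_signs_mk_le (fun i => (v i).1) h₁ fun i => (norm_fst_le _).trans (hv i)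
  have h2 := sum_signs_mk_le (fun i => (v i).2) h₂ fun i => (norm_snd_le _).trans (hv i)
  have hlog : 0 ≤ Real.log N := Real.log_natCast_nonneg _
  have hε : ∀ ε : Fin N → ℤˣ, N * (Real.log N ^ m) ^ 2
      ≤ (B * ‖R‖) ^ 2 * (‖∑ i, ε i • (v i).1‖ ^ 2 + ‖∑ i, ε i • (v i).2‖ ^ 2) := by
    intro ε
    have hlow := norm_mk_sum_unitVec_ge m hN ε
    have hsum : mk half (m + 1) (∑ i, ε i • unitVec i) = ∑ i, ε i • w i := by
      rw [map_sum]
      exact Finset.sum_congr rfl fun i _ => map_units_smul _ _ _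
    have hR : R (∑ i, ε i • v i) = (0, ∑ i, ε i • w i) := by
      have h0 : ((0 : Z a), ∑ i, ε i • w i) = ∑ i, ε i • ((0 : Z a), w i) := by
        ext1 <;> simp [Prod.fst_sum, Prod.snd_sum]
      rw [h0, map_sum]
      exact Finset.sum_congr rfl fun i _ => by rw [map_units_smul, hRS]
    have hup : ‖∑ i, ε i • w i‖ ≤ ‖R‖ * ‖∑ i, ε i • v i‖ :=
      (norm_snd_le (((0 : Z a), ∑ i, ε i • w i))).trans (hR ▸ R.le_opNorm _)
    have hmax : ‖∑ i, ε i • v i‖ ^ 2 ≤ ‖∑ i, ε i • (v i).1‖ ^ 2 + ‖∑ i, ε i • (v i).2‖ ^ 2 := by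
      have h3 : ∑ i, ε i • v i = (∑ i, ε i • (v i).1, ∑ i, ε i • (v i).2) := by
        ext1 <;> simp [Prod.fst_sum, Prod.snd_sum]
      rw [h3, Prod.norm_def]
      rcases max_choice ‖∑ i, ε i • (v i).1‖ ‖∑ i, ε i • (v i).2‖ with h | h
      · exact (congrArg (· ^ 2) h).trans_le (le_add_of_nonneg_right (sq_nonneg _))
      · exact (congrArg (· ^ 2) h).trans_le (le_add_of_nonneg_left (sq_nonneg _))
    rw [hsum] at hlow
    have h5 := pow_le_pow_left₀ (by positivity)
      (hlow.trans (mul_le_mul_of_nonneg_left hup hB0.le)) 2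
    rw [mul_pow, Real.sq_sqrt (Nat.cast_nonneg N), ← mul_assoc, mul_pow (B * ‖R‖)] at h5
    exact h5.trans (mul_le_mul_of_nonneg_left hmax (sq_nonneg _))
  have hadd := Finset.sum_le_sum fun ε (_ : ε ∈ (Finset.univ : Finset (Fin N → ℤˣ))) => hε ε
  rw [Finset.sum_const, Finset.card_univ, nsmul_eq_mul, card_signs, ← Finset.mul_sum,
    Finset.sum_add_distrib, Fintype.card_fin] at hadd
  have hM : (0 : ℝ) < 2 ^ N * N := by positivity
  have hfin : (2 ^ N * N : ℝ) * (Real.log N ^ m) ^ 2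
      ≤ 2 ^ N * N * (2 * B * ‖R‖ * ‖S‖ * A) ^ 2 := by
    -- The two summands contribute a factor 2 to the squares, rounded up to `2 ^ 2`.
    rw [mul_assoc]
    refine hadd.trans ((mul_le_mul_of_nonneg_left (add_le_add h1 h2) (sq_nonneg _)).trans ?_)
    have : 0 ≤ 2 ^ N * N * (B * ‖R‖ * (A * ‖S‖)) ^ 2 := by positivity
    linarith
  exact (sq_le_sq₀ (by positivity) (by positivity)).1 (le_of_mul_le_mul_left hfin hM)

/-- An isomorphism of direct sums of two Rochberg spaces cannot lower the larger order. -/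
theorem le_of_equiv {a b a' b' : ℕ} (hab : a' ≤ b') (hb : 1 ≤ b')
    (e : (Z a × Z b) ≃L[ℂ] (Z a' × Z b')) : b ≤ b' := by
  by_contra! hlt
  -- As `b > b' ≥ 1`, and `a'`, `b'` are at most `m + 1`, the target has type 2 constants of order
  -- at most `(k + 1) ^ m`, while the source forces the power `m + 1`.
  obtain ⟨m, rfl⟩ : ∃ m, b = m + 2 := ⟨b - 2, by omega⟩
  obtain ⟨D₁, hD₁, hT₁⟩ := exists_hasTypeTwo_mkSeminorm a'
  obtain ⟨D₂, hD₂, hT₂⟩ := exists_hasTypeTwo_mkSeminorm b'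
  set D := max D₁ D₂
  have hD : 0 ≤ D := le_max_of_le_left hD₁
  set K : ℝ := 2 * ((m + 1).factorial * 4 ^ (m + 1)) * ‖(e.symm : (Z a' × Z b') →L[ℂ] (Z a × Z (m + 2)))‖ *
    ‖(e : (Z a × Z (m + 2)) →L[ℂ] (Z a' × Z b'))‖ * D
  have hK0 : 0 ≤ K := by positivity
  have key : ∀ k : ℕ, Real.log 2 ^ (m + 1) * (k : ℝ) ^ (m + 1) ≤ K * (k + 1) ^ m := by
    intro k
    have h := log_pow_le_of_leftInverse (N := 2 ^ k) (A := D * (k + 1) ^ m) (by positivity)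
      (by positivity)
      ((hT₁ k).mono (by positivity) (mul_le_mul (le_max_left _ _)
        (pow_le_pow_right₀ (by simp) (by omega)) (by positivity) hD))
      ((hT₂ k).mono (by positivity) (mul_le_mul (le_max_right _ _)
        (pow_le_pow_right₀ (by simp) (by omega)) (by positivity) hD))
      (e : (Z a × Z (m + 2)) →L[ℂ] (Z a' × Z b'))
      (e.symm : (Z a' × Z b') →L[ℂ] (Z a × Z (m + 2))) e.symm_apply_apply
    rw [Nat.cast_pow, Real.log_pow, mul_pow, mul_comm, ← mul_assoc] at h
    exact h
  clear_value K
  have hlog2 : 0 < Real.log 2 := Real.log_pos (by norm_num)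
  -- With `k + 1 ≤ 2 * k`, such a `k` makes the left side of `key` exceed the right.
  obtain ⟨k, hk⟩ := exists_nat_gt (max 1 (K * 2 ^ m / Real.log 2 ^ (m + 1)))
  have hk1 : (1 : ℝ) < k := (le_max_left _ _).trans_lt hk
  have hk2 := (le_max_right _ _).trans_lt hk
  rw [div_lt_iff₀ (by positivity)] at hk2
  have h3 : K * (k + 1 : ℝ) ^ m ≤ K * 2 ^ m * (k : ℝ) ^ m := by
    rw [mul_assoc, ← mul_pow]
    gcongr
    linarith
  have h4 : K * 2 ^ m * (k : ℝ) ^ m < k * Real.log 2 ^ (m + 1) * (k : ℝ) ^ m := by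
    gcongr
  have h5 := (key k).trans h3
  rw [pow_succ (k : ℝ)] at h5
  linarith

end EllCalderon

end Rochberg
end

theorem mainTheorem5 (n k j : ℕ) (hk : k ≤ n) (hj : j ≤ n) :
    Nonempty ((Rochberg.Z (n - k) × Rochberg.Z (n + k)) ≃L[ℂ]
      (Rochberg.Z (n - j) × Rochberg.Z (n + j))) ↔ k = j := by
  constructor
  · rintro ⟨e⟩
    -- For `n = 0` both indices are zero. Otherwise the larger orders `n + k` and `n + j` are
    -- positive and bound each other.
    rcases Nat.eq_zero_or_pos n with rfl | hn
    · omega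
    · have h1 := Rochberg.EllCalderon.le_of_equiv (by omega) (by omega) e
      have h2 := Rochberg.EllCalderon.le_of_equiv (by omega) (by omega) e.symm
      omega
  · rintro rfl
    exact ⟨ContinuousLinearEquiv.refl ℂ _⟩
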